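/- **Setting.** There are $n$ players. Player $i$ has an action set $\mathcal A_i\subseteq\mathbb R^k$, $k\ge 1$. Given matrices $W^*_{ij}\in\mathbb R^{k\times k}$ with $W^*_{ii}=0$, let $S_i=\{j: W^*_{ij}\neq 0\}$ be the in-neighbours of $i$ and $S_i^c=[n]\setminus(S_i\cup\{i\})$; assume $|S_i|\le d$ for all $i$, where $d\ge 1$. The payoff of player $i$ is $u_i(x)=-\|x_i-\sum_{j\in S_i}W^*_{ij}x_j\|_2$. A joint action $x\in\prod_i\mathcal A_i$ is a Nash equilibrium if no player can raise its payoff by changing only its own action within $\mathcal A_i$; it is an $\varepsilon$-Nash equilibrium, $\varepsilon=(\varepsilon_i)_i$, if no player $i$ can raise its payoff in this way by more than $\varepsilon_i$. We observe $x^t=x^{*t}+e^t$, $t=1,\dots,T$, where the $x^{*t}$ are arbitrary (non-random) Nash equilibria and all coordinates of all $e^t_i\in\mathbb R^k$ are mutually independent, of mean zero and sub-Gaussian with variance proxy $\sigma^2$, $\sigma>0$. Put $H=\frac1T\sum_{t=1}^T\big(x^{*t}x^{*t\top}+\mathbb E[e^te^{t\top}]\big)\in\mathbb R^{nk\times nk}$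 (so $\mathbb E[e^te^{t\top}]=\sigma^2 I$ when the noise coordinates have variance $\sigma^2$). For sets of players $R,S$ let $H_{RS}$ be the submatrix with block rows $R$ and block columns $S$, and let $C_{\min,i}$ be the smallest eigenvalue of $H_{S_iS_i}$. Let $W_{\max}$ be the largest absolute value of an entry of the $W^*_{ij}$ and $W_{\min}$ the smallest absolute value of a nonzero entry. The estimator $\hat W$, with $\hat W_{ii}=0$, minimizes for each player $i$ $$\frac1T\sum_{t=1}^T\Big\|x_i^t-\sum_{j\ne i}W_{ij}x_j^t\Big\|_2^2+\lambda\sum_{j\neq i}\|W_{ij}\|_F .$$ **Assumptions.** (1) $\|y\|_2\le b$ for all $i$ and $y\in\mathcal A_i$, where $b>0$. (2) $u_i(x)=0$ for every Nash equilibrium $x$ and every $i$. (3) For some $\alpha\in(0,1]$ and every $i$, $\|H_{S_i^cS_i}H_{S_iS_i}^{-1}\|_{B,\infty,1}\le 1-\alpha$, where $\|M\|_{B,\infty,1}$ is the maximum over the row blocks of $M$ (one block of $k$ rows for each player in $S_i^c$) of the sum of the absolute values of the entries. (4) With $s=|S_i|$ and $s'=|S_i^c|$, for every $i$ the number $\lambda$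 is larger than each of $$24\sqrt2\tfrac{1-\alpha}{\alpha}\sigma bW_{\max}\sqrt{\tfrac{ks\log(2k^2s)}{T}},\quad 192\tfrac{1-\alpha}{\alpha}\sigma^2W_{\max}\sqrt{\tfrac{k\log(k^2s)}{T}},\quad 192\tfrac{1-\alpha}{\alpha}\sigma^2\sqrt k\,W_{\max}\sqrt{\tfrac{W_{\max}s\log(sk)}{TW_{\min}}},$$ $$192\tfrac{1-\alpha}{\alpha}k^{1/4}\sigma\sqrt{\tfrac{\log(2k^2s)}{T}},\quad \tfrac{24\sqrt2}{\alpha}k\sigma bW_{\max}\sqrt{\tfrac{|s'\log(2k^2s')|}{T}},\quad \tfrac{192}{\alpha}\sigma^2kW_{\max}\sqrt{\tfrac{\log(k^2s')}{T}},$$ $$\tfrac{192}{\alpha}\sigma^2kW_{\max}\sqrt{\tfrac{W_{\max}\sqrt{s'}\log(s'k)}{T}},\quad \tfrac{24\sqrt2}{\alpha}k\sigma b\sqrt{\tfrac{\log(2k^2s')}{T}},\quad \tfrac{192}{\alpha}\sigma\sqrt{\tfrac{k\log(2k^2s')}{T}},$$ $$\tfrac{24(1-\alpha)\sigma^2\sqrt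 k\,W_{\max}}{\alpha},\quad \tfrac{24\sigma^2kW_{\max}}{\alpha},$$ where terms containing the logarithm of $0$ (because $s=0$ or $s'=0$) are omitted. For each player let $$\delta_i=\frac{2k\sqrt{k|S_i|}}{C_{\min,i}}\Big(\frac{\alpha\lambda}{24(1-\alpha)}+\sigma^2\Big(1+\frac{2\alpha\lambda}{24(1-\alpha)\sigma^2\sqrt k\,W_{\max}}\Big)\sqrt k\,W_{\max}+\frac{2\alpha\lambda}{24(1-\alpha)}+\frac{\lambda}{2}\Big)$$ (with $\delta_i=0$ if $S_i=\emptyset$). **Theorem.** For all $\sigma,b>0$, $\alpha\in(0,1]$, $c_0>0$ and $\lambda_0>0$ there are constants $C,K>0$, depending on these five numbers only, such that the following holds for all $n,k,d,T$, all games, equilibria, noise and $\lambda$ as above with $\lambda\ge\lambda_0$ and with $C_{\min,i}\ge c_0$ for every $i$ with $S_i\ne\emptyset$. If $$T\ \ge\ C\,k^5d^3\log(dnk),$$ then, with probability at least $1-\exp\big(-KT/(k^5d^3)\big)$, the optimization problems have solutions and every solution $\hat W$ satisfies: 0. $\{j:\hat W_{ij}\ne0\}\subseteq S_i$ for every player $i$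 (no false in-neighbours); and, if $\alpha<1$ (for $\alpha=1$ the radius $\delta_i$ is infinite), 1. $\|\hat W_{ij}-W^*_{ij}\|_F\le\delta_i$ for all $i,j$, and every $x\in\prod_i\mathcal A_i$ with $x_i=\sum_{j\ne i}\hat W_{ij}x_j$ for all $i$ is an $\varepsilon$-Nash equilibrium of the true game with $\varepsilon_i=|S_i|\,\delta_i\,b$; 2. for every player $i$ with $\min_{j\in S_i}\|W^*_{ij}\|_F>2\delta_i$ one has $\{j:\hat W_{ij}\neq0\}=S_i$; so if this holds for all players, the exact structure of the graphical game is recovered. -/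

import Mathlib

open MeasureTheory ProbabilityTheory

noncomputable section

namespace QuadGame

/-- Actions: vectors of `ℝᵏ` with the Euclidean norm. -/
abbrev Vec (k : ℕ) := EuclideanSpace ℝ (Fin k)

/-- Weights `W i j ∈ ℝ^{k × k}`, the influence of player `j` on player `i`. -/
abbrev Weights (n k : ℕ) := Fin n → Fin n → Matrix (Fin k) (Fin k) ℝ

/-- The product `M v` of a matrix and a vector. -/
def act {k : ℕ} (M : Matrix (Fin k) (Fin k) ℝ) (v : Vec k) : Vec k :=
  WithLp.toLp 2 (M.mulVec v.ofLp)

/-- The Frobenius norm. -/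
def frob {k : ℕ} (M : Matrix (Fin k) (Fin k) ℝ) : ℝ :=
  Real.sqrt (∑ a, ∑ c, M a c ^ 2)

/-! ### The game -/

open Classical in
/-- The in-neighbours `S_i` of player `i`. -/
def nbr {n k : ℕ} (W : Weights n k) (i : Fin n) : Finset (Fin n) :=
  Finset.univ.filter (fun j => W i j ≠ 0)

/-- The other players `S_iᶜ`, that is, all players outside `S_i ∪ {i}`. -/
def nbrCompl {n k : ℕ} (W : Weights n k) (i : Fin n) : Finset (Fin n) :=
  Finset.univ \ insert i (nbr W i)

/-- The payoff of player `i` when he plays `y` and the others play according to `x`. -/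
def payoff {n k : ℕ} (W : Weights n k) (i : Fin n) (y : Vec k) (x : Fin n → Vec k) : ℝ :=
  -‖y - ∑ j ∈ nbr W i, act (W i j) (x j)‖

/-- Pure-strategy Nash equilibria of the game with action sets `A` and weights `W`. -/
def nashSet {n k : ℕ} (A : Fin n → Set (Vec k)) (W : Weights n k) : Set (Fin n → Vec k) :=
  {x | (∀ i, x i ∈ A i) ∧ ∀ i, ∀ y ∈ A i, payoff W i y x ≤ payoff W i (x i) x}

/-- Pure-strategy `ε`-Nash equilibria; the slack may depend on the player. -/
def epsNashSet {n k : ℕ} (A : Fin n → Set (Vec k)) (W : Weights n k) (ε : Fin n → ℝ) :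
    Set (Fin n → Vec k) :=
  {x | (∀ i, x i ∈ A i) ∧ ∀ i, ∀ y ∈ A i, -ε i + payoff W i y x ≤ payoff W i (x i) x}

/-- Joint actions that solve the linear system `x_i = ∑_{j ≠ i} W_ij x_j`. -/
def linearSolutions {n k : ℕ} (A : Fin n → Set (Vec k)) (W : Weights n k) :
    Set (Fin n → Vec k) :=
  {x | (∀ i, x i ∈ A i) ∧ ∀ i, x i = ∑ j ∈ Finset.univ.erase i, act (W i j) (x j)}

/-- `max |W_ij|` over all entries of all weight matrices. -/
def Wmax {n k : ℕ} (W : Weights n k) : ℝ :=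
  ⨆ p : (Fin n × Fin n) × (Fin k × Fin k), |W p.1.1 p.1.2 p.2.1 p.2.2|

/-- `min |W_ij|` over all nonzero entries of all weight matrices. -/
def Wmin {n k : ℕ} (W : Weights n k) : ℝ :=
  sInf {r | ∃ i j a c, W i j a c ≠ 0 ∧ r = |W i j a c|}

/-! ### The estimator -/

/-- The regularized least-squares objective of player `i`; `X t` is the `t`-th observation. -/
def objective {n k T : ℕ} (lam : ℝ) (X : Fin T → Fin n → Vec k) (i : Fin n)
    (V : Fin n → Matrix (Fin k) (Fin k) ℝ) : ℝ :=
  (1 / (T : ℝ)) * ∑ t, ‖X t i - ∑ j ∈ Finset.univ.erase i, act (V j) (X t j)‖ ^ 2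
    + lam * ∑ j ∈ Finset.univ.erase i, frob (V j)

/-- `W'` is an estimate: for each player `i`, the family `(W'_ij)_{j ≠ i}` minimizes the objective.
The block `W'_ii` does not enter the objective and is zero by convention. -/
def IsEstimator {n k T : ℕ} (lam : ℝ) (X : Fin T → Fin n → Vec k) (W' : Weights n k) : Prop :=
  ∀ i, W' i i = 0 ∧ ∀ V, objective lam X i (W' i) ≤ objective lam X i V

/-! ### The noise -/

/-- The coordinates of all the noise vectors are mutually independent, of mean zero, and
sub-Gaussian with variance proxy `σ²`. -/
structure IsNoise {n k T : ℕ} {Ω : Type*} [MeasurableSpace Ω] (μ : Measure Ω) (σ : ℝ)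
    (e : Fin T → Fin n → Ω → Vec k) : Prop where
  measurable : ∀ t i a, Measurable (fun ω => e t i ω a)
  indep : iIndepFun (fun (p : Fin T × Fin n × Fin k) (ω : Ω) => e p.1 p.2.1 ω p.2.2) μ
  mean_zero : ∀ t i a, ∫ ω, e t i ω a ∂μ = 0
  subgaussian : ∀ t i a, HasSubgaussianMGF (fun ω => e t i ω a) (Real.toNNReal (σ ^ 2)) μ

/-! ### The population matrix -/

/-- The matrix `H = (1/T) ∑_t (x*ᵗ x*ᵗᵀ + E[eᵗ eᵗᵀ])`. If the noise coordinates have variance `σ²`,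
then `E[eᵗ eᵗᵀ] = σ² I`. -/
def popMatrix {n k T : ℕ} {Ω : Type*} [MeasurableSpace Ω] (μ : Measure Ω)
    (xs : Fin T → Fin n → Vec k) (e : Fin T → Fin n → Ω → Vec k) :
    Matrix (Fin n × Fin k) (Fin n × Fin k) ℝ :=
  Matrix.of fun p q => (1 / (T : ℝ)) *
    ∑ t, (xs t p.1 p.2 * xs t q.1 q.2 + ∫ ω, e t p.1 ω p.2 * e t q.1 ω q.2 ∂μ)

/-- The submatrix with the block rows in `R` and the block columns in `S`. -/
def blocks {n k : ℕ} (H : Matrix (Fin n × Fin k) (Fin n × Fin k) ℝ) (R S : Finset (Fin n)) :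
    Matrix (R × Fin k) (S × Fin k) ℝ :=
  H.submatrix (fun p => (p.1.1, p.2)) (fun p => (p.1.1, p.2))

/-- The norm `‖·‖_{B,∞,1}`: maximum over the row blocks of the sum of absolute values. -/
def blockInfOne {n k : ℕ} {m : Type*} [Fintype m] {R : Finset (Fin n)}
    (M : Matrix (R × Fin k) m ℝ) : ℝ :=
  ⨆ j : R, ∑ a : Fin k, ∑ q : m, |M (j, a) q|

/-- The smallest real eigenvalue of a square matrix. -/
def minEigenvalue {m : Type*} [Fintype m] [DecidableEq m] (M : Matrix m m ℝ) : ℝ :=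
  sInf {r | Module.End.HasEigenvalue (Matrix.toLin' M) r}

/-- Mutual incoherence at player `i`. -/
def MutualIncoherence {n k : ℕ} (H : Matrix (Fin n × Fin k) (Fin n × Fin k) ℝ)
    (W : Weights n k) (i : Fin n) (α : ℝ) : Prop :=
  blockInfOne (blocks H (nbrCompl W i) (nbr W i) * (blocks H (nbr W i) (nbr W i))⁻¹) ≤ 1 - α

/-- `C_min` of player `i`, the smallest eigenvalue of `H_{S_i S_i}`. -/
def Cmin {n k : ℕ} (H : Matrix (Fin n × Fin k) (Fin n × Fin k) ℝ)
    (W : Weights n k) (i : Fin n) : ℝ :=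
  minEigenvalue (blocks H (nbr W i) (nbr W i))

/-! ### The explicit quantities -/

/-- `lam` exceeds every term of the threshold; `s = |S_i|`, `s' = |S_iᶜ|`, `wM = W_max`,
`wm = W_min`. -/
def ExceedsThreshold (k T s s' : ℕ) (σ b α wM wm lam : ℝ) : Prop :=
  24 * √2 * ((1 - α) / α) * σ * b * wM * √(k * s * Real.log (2 * k ^ 2 * s) / T) < lam ∧
  192 * ((1 - α) / α) * σ ^ 2 * wM * √(k * Real.log (k ^ 2 * s) / T) < lam ∧
  192 * ((1 - α) / α) * σ ^ 2 * √k * wM * √(wM * s * Real.log (s * k) / (T * wm)) < lam ∧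
  192 * ((1 - α) / α) * (k : ℝ) ^ (1 / 4 : ℝ) * σ * √(Real.log (2 * k ^ 2 * s) / T) < lam ∧
  24 * √2 / α * k * σ * b * wM * √(|s' * Real.log (2 * k ^ 2 * s')| / T) < lam ∧
  192 / α * σ ^ 2 * k * wM * √(Real.log (k ^ 2 * s') / T) < lam ∧
  192 / α * σ ^ 2 * k * wM * √(wM * √s' * Real.log (s' * k) / T) < lam ∧
  24 * √2 / α * k * σ * b * √(Real.log (2 * k ^ 2 * s') / T) < lam ∧
  192 / α * σ * √(k * Real.log (2 * k ^ 2 * s') / T) < lam ∧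
  24 * (1 - α) * σ ^ 2 * √k * wM / α < lam ∧
  24 * σ ^ 2 * k * wM / α < lam

/-- The radius `δ(k, |S_i|, C_min, α, λ, σ, W_max)`. -/
def delta (k s : ℕ) (cmin α lam σ wM : ℝ) : ℝ :=
  k * √(k * s) * (2 / cmin) *
      (α * lam / (24 * (1 - α)) +
        σ ^ 2 * (1 + α * lam / (24 * (1 - α) * σ ^ 2 * √k * wM)
          + α * lam / (24 * (1 - α) * σ ^ 2 * √k * wM)) * (√k * wM)) +
    k * √(k * s) * (2 / cmin) * (α * lam / (24 * (1 - α)) + α * lam / (24 * (1 - α))) +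
    lam / 2 * k * √(k * s) * (2 / cmin)

/-- The claims about one data set `X`: estimates exist, and every estimate `W'` has no false
in-neighbours, lies (with `δ i` the radius of player `i`) within `δ i` of the truth in every block,
has all its equilibria among the `|S_i| δ i b`-equilibria of the true game, and has exactly the true
in-neighbours of every player whose weights are larger than `2 δ i`. For `α = 1` the radius is
infinite, and only the first of these claims has content. -/
def Success {n k T : ℕ} (A : Fin n → Set (Vec k)) (W : Weights n k) (α b lam : ℝ)
    (δ : Fin n → ℝ) (X : Fin T → Fin n → Vec k) : Prop :=
  (∃ W', IsEstimator lam X W') ∧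
  ∀ W', IsEstimator lam X W' →
    (∀ i, nbr W' i ⊆ nbr W i) ∧
    (α < 1 →
      (∀ i j, frob (W' i j - W i j) ≤ δ i) ∧
      linearSolutions A W' ⊆ epsNashSet A W (fun i => ((nbr W i).card : ℝ) * δ i * b) ∧
      ∀ i, (∀ j ∈ nbr W i, 2 * δ i < frob (W i j)) → nbr W' i = nbr W i)

end QuadGame

end

/-! The proof is a primal-dual witness argument in which all randomness is confined to one event:
every entry of the empirical second-moment matrix is within `c₁ / (k * d)` of `popMatrix`. Each
deviation is an average of independent centred terms, affine plus quadratic in the noise. Squares of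
sub-Gaussian variables have exponential moments, so Bernstein's inequality and a union bound apply
(`IsNoise.measure_exists_empMatrix_dev_le`). Because `lam₀` and `c₀` bound the penalty and the
smallest eigenvalues from below, `c₁` is a constant, and the condition on `T` absorbs the union
bound.

On that event everything is deterministic. Fix a player with in-neighbours `S`, and minimize the
objective over families supported on `S`. The residual `R` (minus half the gradient) has blocks of
norm at most `lam / 2` on `S`. Equilibria of zero payoff satisfy the linear system exactly, so the
residual `N` at the true weights consists of the errors-in-variables bias, which the threshold on
`lam` dominates, and a small fluctuation (`IsNoise.norm_empirical_resid_le`).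

With `D` the error and `B` the empirical matrix, `R = N - D B`. The smallest eigenvalue on `S` turns
this into a bound on `D` (`sqrt_sum_norm_sq_le`), and incoherence carries the bound on `D H` from
`S` to the other players, giving `‖R j‖ < lam / 2` there (`norm_lt_of_incoherent`). This strict dual
feasibility forces every unrestricted minimizer to vanish off `S` (`IsSupportedMin.isMin`). Hence
every estimate is a supported minimizer and inherits the error bound, which `le_delta` compares with
`delta`; the equilibrium and recovery claims follow from it. -/

/-! ### Exponential moments of squares of sub-Gaussian variables. -/

theorem lintegral_exp_sq_div_four_gaussianReal_le :
    ∫⁻ g, ENNReal.ofReal (Real.exp (g ^ 2 / 4)) ∂(gaussianReal 0 1) ≤ ENNReal.ofReal 2 := by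
  rw [gaussianReal_of_var_ne_zero _ one_ne_zero,
    lintegral_withDensity_eq_lintegral_mul _ (measurable_gaussianPDF 0 1) (by fun_prop)]
  have h : ∀ g : ℝ, (gaussianPDF 0 1 * fun g : ℝ => ENNReal.ofReal (Real.exp (g ^ 2 / 4))) g
      = ENNReal.ofReal ((√(2 * Real.pi))⁻¹ * Real.exp (-(1 / 4) * g ^ 2)) := by
    intro g
    simp only [Pi.mul_apply, gaussianPDF]
    rw [← ENNReal.ofReal_mul (gaussianPDFReal_nonneg 0 1 g), gaussianPDFReal_def]
    congr 1
    simp only [NNReal.coe_one, mul_one, sub_zero]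
    rw [mul_assoc, ← Real.exp_add]
    congr 2
    ring
  simp_rw [h]
  have hint : Integrable (fun g : ℝ => (√(2 * Real.pi))⁻¹ * Real.exp (-(1 / 4) * g ^ 2)) :=
    (integrable_exp_neg_mul_sq (by norm_num)).const_mul _
  rw [← ofReal_integral_eq_lintegral_ofReal hint (ae_of_all _ fun g => by positivity),
    integral_const_mul, integral_gaussian]
  apply ENNReal.ofReal_le_ofReal
  rw [inv_mul_le_iff₀ (by positivity)]
  apply Real.sqrt_le_iff.2 ⟨by positivity, ?_⟩
  rw [mul_pow, Real.sq_sqrt (by positivity)]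
  nlinarith [Real.pi_pos]

section

variable {Ω : Type*} [MeasurableSpace Ω] {μ : Measure Ω}

/-- Gaussian linearization: `exp (x² / (4σ²))` is the mean of `exp (x g / (√2 σ))` over a standard
normal `g`. After exchanging the integrals, the sub-Gaussian bound at `g / (√2 σ)` leaves `exp (g² /
4)`. Lower integrals make the exchange free of integrability conditions, and finiteness comes out as
a by-product. -/
theorem lintegral_exp_sq_le_of_subgaussian [IsProbabilityMeasure μ] {X : Ω → ℝ} {σ : ℝ} (hσ : 0 < σ)
    (hX : HasSubgaussianMGF X (Real.toNNReal (σ ^ 2)) μ) (hm : Measurable X) :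
    ∫⁻ ω, ENNReal.ofReal (Real.exp (X ω ^ 2 / (4 * σ ^ 2))) ∂μ ≤ ENNReal.ofReal 2 := by
  have hc : ∀ x : ℝ, ENNReal.ofReal (Real.exp (x ^ 2 / (4 * σ ^ 2)))
      = ∫⁻ g, ENNReal.ofReal (Real.exp (x / (√2 * σ) * g)) ∂(gaussianReal 0 1) := by
    intro x
    have h1 := congrFun (mgf_id_gaussianReal (μ := 0) (v := 1)) (x / (√2 * σ))
    simp only [mgf, id] at h1
    rw [← ofReal_integral_eq_lintegral_ofReal _ (ae_of_all _ fun g => by positivity), h1]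
    · congr 2
      rw [div_pow, mul_pow, Real.sq_sqrt (by norm_num)]
      simp
      ring
    · exact integrable_exp_mul_gaussianReal _
  simp_rw [hc]
  rw [lintegral_lintegral_swap (by fun_prop)]
  refine le_trans (lintegral_mono fun g => ?_) lintegral_exp_sq_div_four_gaussianReal_le
  have h2 : ∀ ω, X ω / (√2 * σ) * g = g / (√2 * σ) * X ω := fun ω => by ring
  simp_rw [h2]
  rw [← ofReal_integral_eq_lintegral_ofReal (hX.integrable_exp_mul _)
    (ae_of_all _ fun g => by positivity)]
  apply ENNReal.ofReal_le_ofReal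
  refine (hX.mgf_le _).trans (Real.exp_le_exp.2 (le_of_eq ?_))
  rw [Real.coe_toNNReal _ (sq_nonneg σ), div_pow, mul_pow, Real.sq_sqrt (by norm_num)]
  field_simp
  norm_num

theorem integrable_exp_sq_of_subgaussian [IsProbabilityMeasure μ] {X : Ω → ℝ} {σ : ℝ} (hσ : 0 < σ)
    (hX : HasSubgaussianMGF X (Real.toNNReal (σ ^ 2)) μ) (hm : Measurable X) :
    Integrable (fun ω => Real.exp (X ω ^ 2 / (4 * σ ^ 2))) μ := by
  refine ⟨by fun_prop, ?_⟩
  rw [hasFiniteIntegral_iff_ofReal (ae_of_all _ fun ω => by positivity)]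
  exact (lintegral_exp_sq_le_of_subgaussian hσ hX hm).trans_lt ENNReal.ofReal_lt_top

theorem integral_exp_sq_le_of_subgaussian [IsProbabilityMeasure μ] {X : Ω → ℝ} {σ : ℝ} (hσ : 0 < σ)
    (hX : HasSubgaussianMGF X (Real.toNNReal (σ ^ 2)) μ) (hm : Measurable X) :
    ∫ ω, Real.exp (X ω ^ 2 / (4 * σ ^ 2)) ∂μ ≤ 2 := by
  have h := lintegral_exp_sq_le_of_subgaussian hσ hX hm
  rw [← ofReal_integral_eq_lintegral_ofReal (integrable_exp_sq_of_subgaussian hσ hX hm)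
    (ae_of_all _ fun g => by positivity)] at h
  exact (ENNReal.ofReal_le_ofReal_iff (by norm_num)).1 h

/-- Average the moment generating function at `±1/σ` and use `1 + x²/2 ≤ cosh x`; each of the two
values is at most `exp (1/2) ≤ 2`. The factor 2 is not optimal but suffices. -/
theorem integral_sq_le_of_subgaussian [IsProbabilityMeasure μ] {X : Ω → ℝ} {σ : ℝ} (hσ : 0 < σ)
    (hX : HasSubgaussianMGF X (Real.toNNReal (σ ^ 2)) μ) :
    ∫ ω, X ω ^ 2 ∂μ ≤ 2 * σ ^ 2 := by
  have hpt : ∀ x : ℝ, 1 + x ^ 2 / 2 ≤ (Real.exp x + Real.exp (-x)) / 2 := fun x => by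
    rw [← Real.cosh_eq]
    have h1 := Real.cosh_two_mul (x / 2)
    have h2 := Real.cosh_sq (x / 2)
    have h3 : (x / 2) ^ 2 ≤ Real.sinh (x / 2) ^ 2 := by
      rw [sq_le_sq, Real.abs_sinh]
      exact Real.self_le_sinh_iff.2 (abs_nonneg _)
    rw [mul_div_cancel₀ x two_ne_zero] at h1
    linarith
  have hint : Integrable (fun ω => X ω ^ 2) μ := by
    simpa using (hX.memLp 2).integrable_sq
  have h1 := hX.mgf_le σ⁻¹
  have h2 := hX.mgf_le (-σ⁻¹)
  have i1 := hX.integrable_exp_mul σ⁻¹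
  have i2 := hX.integrable_exp_mul (-σ⁻¹)
  have hv : (Real.toNNReal (σ ^ 2) : ℝ) = σ ^ 2 := Real.coe_toNNReal _ (sq_nonneg σ)
  rw [hv] at h1 h2
  have e1 : σ ^ 2 * σ⁻¹ ^ 2 / 2 = 1 / 2 := by field_simp
  have e2 : σ ^ 2 * (-σ⁻¹) ^ 2 / 2 = 1 / 2 := by field_simp
  rw [e1] at h1
  rw [e2] at h2
  have hmono : ∫ ω, (1 + σ⁻¹ ^ 2 / 2 * X ω ^ 2) ∂μ
      ≤ ∫ ω, (1 / 2) * (Real.exp (σ⁻¹ * X ω) + Real.exp (-σ⁻¹ * X ω)) ∂μ := by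
    refine integral_mono ((integrable_const _).add (hint.const_mul _)) ((i1.add i2).const_mul _)
      fun ω => ?_
    have := hpt (σ⁻¹ * X ω)
    simp only [neg_mul]
    nlinarith
  rw [integral_add (integrable_const _) (hint.const_mul _), integral_const_mul,
    integral_const_mul, integral_add i1 i2] at hmono
  simp only [mgf] at h1 h2
  have h3 : Real.exp (1 / 2) ≤ 2 := by
    rw [← Real.le_log_iff_exp_le (by norm_num)]
    linarith [Real.log_two_gt_d9]
  simp only [integral_const, probReal_univ, smul_eq_mul, mul_one] at hmono
  have h4 : σ⁻¹ ^ 2 / 2 * ∫ ω, X ω ^ 2 ∂μ ≤ 1 := by linarith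
  have h5 : σ⁻¹ ^ 2 / 2 * ∫ ω, X ω ^ 2 ∂μ = (∫ ω, X ω ^ 2 ∂μ) / (2 * σ ^ 2) := by
    field_simp
  rw [h5, div_le_one (by positivity)] at h4
  exact h4

/-! ### Bernstein's inequality from a two-sided exponential moment. -/

theorem exp_le_one_add_add_sq_mul_exp_abs (x : ℝ) :
    Real.exp x ≤ 1 + x + x ^ 2 * Real.exp |x| := by
  have h1 : 1 ≤ Real.exp |x| := Real.one_le_exp (abs_nonneg x)
  rcases le_or_gt |x| 1 with h | h
  · have h2 := abs_le.1 (Real.abs_exp_sub_one_sub_id_le h)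
    nlinarith [sq_nonneg x]
  · rcases abs_cases x with ⟨hx, h0⟩ | ⟨hx, h0⟩
    · rw [hx] at h h1 ⊢
      have h2 : Real.exp x * 1 ≤ Real.exp x * x ^ 2 := by gcongr; nlinarith
      linarith
    · have : Real.exp x ≤ 1 := Real.exp_le_one_iff.2 h0.le
      nlinarith [sq_nonneg x]

theorem integrable_exp_mul_of_exp_abs {Z : Ω → ℝ} {θ s : ℝ} (hZ : Measurable Z)
    (hi : Integrable (fun ω => Real.exp (θ * |Z ω|)) μ) (hs : |s| ≤ θ) :
    Integrable (fun ω => Real.exp (s * Z ω)) μ := by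
  refine hi.mono' (by fun_prop) (ae_of_all _ fun ω => ?_)
  rw [Real.norm_eq_abs, abs_of_pos (Real.exp_pos _)]
  apply Real.exp_le_exp.2
  calc s * Z ω ≤ |s * Z ω| := le_abs_self _
    _ = |s| * |Z ω| := abs_mul _ _
    _ ≤ θ * |Z ω| := by gcongr

variable [IsProbabilityMeasure μ]

/-- In the second-order bound for `exp (s z)` the linear term has mean zero. Since `|s| ≤ θ / 2`,
half of the exponent `θ |z|` bounds `exp |s z|` and the other half pays for `z²`. -/
theorem mgf_le_of_exp_abs {Z : Ω → ℝ} {θ M s : ℝ} (hθ : 0 < θ) (hZ : Measurable Z)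
    (hi : Integrable (fun ω => Real.exp (θ * |Z ω|)) μ)
    (hM : ∫ ω, Real.exp (θ * |Z ω|) ∂μ ≤ M) (h0 : ∫ ω, Z ω ∂μ = 0) (hs : |s| ≤ θ / 2) :
    mgf Z μ s ≤ Real.exp (8 * M / θ ^ 2 * s ^ 2) := by
  have hpt : ∀ z : ℝ, Real.exp (s * z) ≤ 1 + s * z + 8 / θ ^ 2 * s ^ 2 * Real.exp (θ * |z|) := by
    intro z
    refine (exp_le_one_add_add_sq_mul_exp_abs _).trans ?_
    have h1 : Real.exp |s * z| ≤ Real.exp (θ / 2 * |z|) := by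
      rw [abs_mul]
      gcongr
    have h2 : z ^ 2 ≤ 8 / θ ^ 2 * Real.exp (θ / 2 * |z|) := by
      have h3 := Real.quadratic_le_exp_of_nonneg (x := θ / 2 * |z|) (by positivity)
      have h4 : (θ / 2 * |z|) ^ 2 / 2 = θ ^ 2 / 8 * z ^ 2 := by
        rw [mul_pow, sq_abs]; ring
      have h5 : θ ^ 2 / 8 * z ^ 2 ≤ Real.exp (θ / 2 * |z|) := by
        have : 0 ≤ θ / 2 * |z| := by positivity
        linarith
      have h6 : z ^ 2 = 8 / θ ^ 2 * (θ ^ 2 / 8 * z ^ 2) := by field_simp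
      rw [h6]
      gcongr
    have h7 : Real.exp (θ * |z|) = Real.exp (θ / 2 * |z|) * Real.exp (θ / 2 * |z|) := by
      rw [← Real.exp_add]; ring_nf
    rw [h7, mul_pow]
    have : s ^ 2 * z ^ 2 * Real.exp |s * z|
        ≤ s ^ 2 * (8 / θ ^ 2 * Real.exp (θ / 2 * |z|)) * Real.exp (θ / 2 * |z|) := by gcongr
    linarith
  have hZi : Integrable Z μ := by
    refine (hi.const_mul θ⁻¹).mono' (by fun_prop) (ae_of_all _ fun ω => ?_)
    rw [Real.norm_eq_abs]
    have := Real.add_one_le_exp (θ * |Z ω|)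
    rw [le_inv_mul_iff₀ hθ]
    linarith
  have hle : mgf Z μ s
      ≤ ∫ ω, (1 + s * Z ω + 8 / θ ^ 2 * s ^ 2 * Real.exp (θ * |Z ω|)) ∂μ :=
    integral_mono (integrable_exp_mul_of_exp_abs hZ hi (by linarith))
      (((integrable_const _).add (hZi.const_mul _)).add (hi.const_mul _)) fun ω => hpt _
  have hsum : ∫ ω, (1 + s * Z ω + 8 / θ ^ 2 * s ^ 2 * Real.exp (θ * |Z ω|)) ∂μ
      = 1 + 8 / θ ^ 2 * s ^ 2 * ∫ ω, Real.exp (θ * |Z ω|) ∂μ := by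
    rw [integral_add (f := fun ω => 1 + s * Z ω) ((integrable_const _).add (hZi.const_mul _))
      (hi.const_mul _), integral_add (integrable_const _) (hZi.const_mul _), integral_const_mul,
      integral_const_mul, h0]
    simp
  rw [hsum] at hle
  refine hle.trans ?_
  have h8 : 8 / θ ^ 2 * s ^ 2 * ∫ ω, Real.exp (θ * |Z ω|) ∂μ ≤ 8 / θ ^ 2 * s ^ 2 * M := by gcongr
  have h9 := Real.add_one_le_exp (8 * M / θ ^ 2 * s ^ 2)
  have h10 : 8 / θ ^ 2 * s ^ 2 * M = 8 * M / θ ^ 2 * s ^ 2 := by ring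
  linarith

/-- Bernstein's inequality for independent variables with a common exponential moment. -/
theorem measure_sum_ge_le_of_exp_abs {T : ℕ} {Z : Fin T → Ω → ℝ} {θ M ε : ℝ} (hθ : 0 < θ)
    (hM1 : 1 ≤ M) (hε : 0 ≤ ε) (hεθ : ε ≤ 8 / θ) (hind : iIndepFun Z μ)
    (hZ : ∀ t, Measurable (Z t))
    (hi : ∀ t, Integrable (fun ω => Real.exp (θ * |Z t ω|)) μ)
    (hM : ∀ t, ∫ ω, Real.exp (θ * |Z t ω|) ∂μ ≤ M) (h0 : ∀ t, ∫ ω, Z t ω ∂μ = 0) :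
    μ.real {ω | T * ε ≤ ∑ t, Z t ω} ≤ Real.exp (-(θ ^ 2 / (32 * M) * (T * ε ^ 2))) := by
  -- The minimizer of `-s * ε + 8 * M / θ ^ 2 * s ^ 2`. The conditions `ε ≤ 8 / θ` and `1 ≤ M` keep
  -- it in the range `s ≤ θ / 2`.
  set s : ℝ := θ ^ 2 * ε / (16 * M) with hs
  have hs0 : 0 ≤ s := by positivity
  have hsθ : |s| ≤ θ / 2 := by
    rw [abs_of_nonneg hs0, hs, div_le_iff₀ (by positivity)]
    have : θ * ε ≤ 8 := by
      rw [le_div_iff₀ hθ] at hεθ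
      linarith
    nlinarith
  have hint : Integrable (fun ω => Real.exp (s * (∑ t, Z t) ω)) μ :=
    hind.integrable_exp_mul_sum hZ fun t _ =>
      integrable_exp_mul_of_exp_abs (hZ t) (hi t) (by linarith)
  have h1 := measure_ge_le_exp_mul_mgf (X := ∑ t, Z t) (μ := μ) (T * ε) hs0 hint
  rw [hind.mgf_sum hZ] at h1
  have h2 : ∏ t, mgf (Z t) μ s ≤ ∏ _t : Fin T, Real.exp (8 * M / θ ^ 2 * s ^ 2) :=
    Finset.prod_le_prod (fun t _ => mgf_nonneg) fun t _ =>
      mgf_le_of_exp_abs hθ (hZ t) (hi t) (hM t) (h0 t) hsθ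
  rw [Finset.prod_const, Finset.card_univ, Fintype.card_fin, ← Real.exp_nat_mul] at h2
  simp only [Finset.sum_apply] at h1
  refine h1.trans ((mul_le_mul_of_nonneg_left h2 (Real.exp_pos _).le).trans (le_of_eq ?_))
  rw [← Real.exp_add]
  congr 1
  rw [hs]
  field_simp
  ring

theorem measure_abs_sum_ge_le_of_exp_abs {T : ℕ} {Z : Fin T → Ω → ℝ} {θ M ε : ℝ} (hθ : 0 < θ)
    (hM1 : 1 ≤ M) (hε : 0 ≤ ε) (hεθ : ε ≤ 8 / θ) (hind : iIndepFun Z μ)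
    (hZ : ∀ t, Measurable (Z t))
    (hi : ∀ t, Integrable (fun ω => Real.exp (θ * |Z t ω|)) μ)
    (hM : ∀ t, ∫ ω, Real.exp (θ * |Z t ω|) ∂μ ≤ M) (h0 : ∀ t, ∫ ω, Z t ω ∂μ = 0) :
    μ.real {ω | T * ε ≤ |∑ t, Z t ω|} ≤ 2 * Real.exp (-(θ ^ 2 / (32 * M) * (T * ε ^ 2))) := by
  have h1 := measure_sum_ge_le_of_exp_abs hθ hM1 hε hεθ hind hZ hi hM h0
  have h2 := measure_sum_ge_le_of_exp_abs (Z := fun t ω => -Z t ω) hθ hM1 hε hεθ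
    (hind.comp (fun _ x => -x) fun _ => measurable_neg) (fun t => (hZ t).neg)
    (by simpa using hi) (by simpa using hM) (by simpa [integral_neg] using h0)
  have h3 : {ω | T * ε ≤ |∑ t, Z t ω|}
      ⊆ {ω | T * ε ≤ ∑ t, Z t ω} ∪ {ω | T * ε ≤ ∑ t, -Z t ω} := by
    intro ω hω
    simp only [Set.mem_ofPred_eq, Set.mem_union, Finset.sum_neg_distrib] at hω ⊢
    exact le_abs.1 hω
  refine (measureReal_mono h3).trans ((measureReal_union_le _ _).trans ?_)
  linarith

/-- The rows of a family of independent variables indexed by pairs are independent. -/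
theorem iIndepFun_rows {ι κ : Type*} {X : ι × κ → Ω → ℝ} (hm : ∀ p, Measurable (X p))
    (hX : iIndepFun X μ) : iIndepFun (fun i ω j => X (i, j) ω) μ := by
  have hS : iIndepFun (fun (p : (_ : ι) × κ) ω => X (p.1, p.2) ω) μ :=
    hX.precomp (g := Equiv.sigmaEquivProd ι κ) (Equiv.injective _)
  have hprob : ∀ i j, IsProbabilityMeasure (μ.map (X (i, j))) := fun i j =>
    Measure.isProbabilityMeasure_map (hm _).aemeasurable
  have hS' := (iIndepFun_iff_map_fun_eq_infinitePi_map (fun p => hm _)).1 hS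
  rw [iIndepFun_iff_map_fun_eq_infinitePi_map
    (fun i => measurable_pi_lambda _ fun j => hm (i, j))]
  have hrow : ∀ i, μ.map (fun ω j => X (i, j) ω)
      = Measure.infinitePi fun j => μ.map (X (i, j)) := fun i =>
    (iIndepFun_iff_map_fun_eq_infinitePi_map (fun j => hm (i, j))).1
      (hX.precomp (g := fun j => (i, j)) (Prod.mk_right_injective i))
  simp_rw [hrow]
  -- Independence is the statement that the joint law is a product; currying turns the product over
  -- pairs into the product of the laws of the rows.
  rw [← Measure.infinitePi_map_piCurry (fun i j => μ.map (X (i, j))), ← hS',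
    Measure.map_map (by fun_prop) (measurable_pi_lambda _ fun p => hm _)]
  rfl

end

/-! ### Concentration of the empirical second moments. -/

noncomputable section

namespace QuadGame

/-- The empirical second-moment matrix. -/
def empMatrix {n k T : ℕ} (X : Fin T → Fin n → Vec k) :
    Matrix (Fin n × Fin k) (Fin n × Fin k) ℝ :=
  Matrix.of fun p q => (1 / (T : ℝ)) * ∑ t, X t p.1 p.2 * X t q.1 q.2

/-- The rate in the exponential tail bound for the empirical second moments. -/
def tailRate (σ b : ℝ) : ℝ :=
  (1 / (8 * σ ^ 2)) ^ 2 / (32 * (2 * Real.exp (1 / (8 * σ ^ 2) * (b ^ 2 + 2 * σ ^ 2))))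

theorem tailRate_pos {σ : ℝ} (hσ : 0 < σ) (b : ℝ) : 0 < tailRate σ b := by
  unfold tailRate
  positivity

section

variable {n k T : ℕ} {Ω : Type*} [MeasurableSpace Ω] {μ : Measure Ω} {σ b : ℝ}
  {e : Fin T → Fin n → Ω → Vec k}

theorem IsNoise.integrable_mul (he : IsNoise μ σ e) (t : Fin T) (p q : Fin n × Fin k) :
    Integrable (fun ω => e t p.1 ω p.2 * e t q.1 ω q.2) μ :=
  MemLp.integrable_mul (p := 2) (q := 2) (by simpa using (he.subgaussian t p.1 p.2).memLp 2)
    (by simpa using (he.subgaussian t q.1 q.2).memLp 2)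

theorem IsNoise.integral_mul_eq_zero (he : IsNoise μ σ e) (t : Fin T) {p q : Fin n × Fin k}
    (hpq : p ≠ q) : ∫ ω, e t p.1 ω p.2 * e t q.1 ω q.2 ∂μ = 0 := by
  have h := he.indep.indepFun (i := (t, p)) (j := (t, q)) (by simpa using hpq)
  have h1 := h.integral_mul_eq_mul_integral (he.measurable t p.1 p.2).aestronglyMeasurable
    (he.measurable t q.1 q.2).aestronglyMeasurable
  simp only [Pi.mul_apply] at h1
  rw [h1, he.mean_zero, zero_mul]

theorem IsNoise.integral_sq_le [IsProbabilityMeasure μ] (he : IsNoise μ σ e) (hσ : 0 < σ)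
    (t : Fin T) (p : Fin n × Fin k) :
    ∫ ω, e t p.1 ω p.2 ^ 2 ∂μ ≤ 2 * σ ^ 2 :=
  integral_sq_le_of_subgaussian hσ (he.subgaussian t p.1 p.2)

theorem IsNoise.abs_integral_mul_le [IsProbabilityMeasure μ] (he : IsNoise μ σ e) (hσ : 0 < σ)
    (t : Fin T) (p q : Fin n × Fin k) : |∫ ω, e t p.1 ω p.2 * e t q.1 ω q.2 ∂μ| ≤ 2 * σ ^ 2 := by
  rcases eq_or_ne p q with rfl | h
  · simp_rw [← sq]
    rw [abs_of_nonneg (integral_nonneg fun ω => sq_nonneg _)]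
    exact he.integral_sq_le hσ t p
  · rw [he.integral_mul_eq_zero t h, abs_zero]
    positivity

/-- The deviation of one observed product of coordinates from its expectation. -/
def crossDev (μ : Measure Ω) (xs : Fin T → Fin n → Vec k) (e : Fin T → Fin n → Ω → Vec k)
    (p q : Fin n × Fin k) (t : Fin T) (ω : Ω) : ℝ :=
  xs t p.1 p.2 * e t q.1 ω q.2 + xs t q.1 q.2 * e t p.1 ω p.2 + e t p.1 ω p.2 * e t q.1 ω q.2
    - ∫ ω, e t p.1 ω p.2 * e t q.1 ω q.2 ∂μ

theorem empMatrix_sub_popMatrix (xs : Fin T → Fin n → Vec k) (p q : Fin n × Fin k) (ω : Ω) :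
    empMatrix (fun t i => xs t i + e t i ω) p q - popMatrix μ xs e p q
      = (1 / (T : ℝ)) * ∑ t, crossDev μ xs e p q t ω := by
  simp only [empMatrix, popMatrix, Matrix.of_apply, crossDev]
  rw [← mul_sub, ← Finset.sum_sub_distrib]
  congr 1
  refine Finset.sum_congr rfl fun t _ => ?_
  simp only [PiLp.add_apply]
  ring

theorem IsNoise.measurable_crossDev (he : IsNoise μ σ e) (xs : Fin T → Fin n → Vec k)
    (p q : Fin n × Fin k) (t : Fin T) : Measurable (crossDev μ xs e p q t) := by
  have h1 := he.measurable t p.1 p.2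
  have h2 := he.measurable t q.1 q.2
  exact (((h2.const_mul _).add (h1.const_mul _)).add (h1.mul h2)).sub_const _

variable [IsProbabilityMeasure μ]

theorem IsNoise.iIndepFun_crossDev (he : IsNoise μ σ e) (xs : Fin T → Fin n → Vec k)
    (p q : Fin n × Fin k) : iIndepFun (crossDev μ xs e p q) μ :=
  (iIndepFun_rows (fun r => he.measurable r.1 r.2.1 r.2.2) he.indep).comp
    (fun t r => xs t p.1 p.2 * r q + xs t q.1 q.2 * r p + r p * r q
      - ∫ ω, e t p.1 ω p.2 * e t q.1 ω q.2 ∂μ) fun t => by fun_prop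

theorem IsNoise.integral_crossDev (he : IsNoise μ σ e) (xs : Fin T → Fin n → Vec k)
    (p q : Fin n × Fin k) (t : Fin T) : ∫ ω, crossDev μ xs e p q t ω ∂μ = 0 := by
  have hp := (he.subgaussian t p.1 p.2).integrable
  have hq := (he.subgaussian t q.1 q.2).integrable
  have hpq := he.integrable_mul t p q
  have h1 : Integrable (fun ω => xs t p.1 p.2 * e t q.1 ω q.2 + xs t q.1 q.2 * e t p.1 ω p.2) μ :=
    (hq.const_mul _).add (hp.const_mul _)
  have h2 : Integrable (fun ω => xs t p.1 p.2 * e t q.1 ω q.2 + xs t q.1 q.2 * e t p.1 ω p.2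
      + e t p.1 ω p.2 * e t q.1 ω q.2) μ := h1.add hpq
  unfold crossDev
  rw [integral_sub h2 (integrable_const _), integral_add h1 hpq,
    integral_add (hq.const_mul _) (hp.const_mul _), integral_const_mul, integral_const_mul,
    he.mean_zero, he.mean_zero]
  simp

/-- Each of the three products is at most half the sum of the squares of its factors, so only
squares of noise coordinates remain. -/
theorem IsNoise.abs_crossDev_le (he : IsNoise μ σ e) (hσ : 0 < σ) {xs : Fin T → Fin n → Vec k}
    (hxs : ∀ t i, ‖xs t i‖ ≤ b) (p q : Fin n × Fin k) (t : Fin T) (ω : Ω) :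
    |crossDev μ xs e p q t ω|
      ≤ b ^ 2 + 2 * σ ^ 2 + (e t p.1 ω p.2 ^ 2 + e t q.1 ω q.2 ^ 2) := by
  have hx : ∀ p : Fin n × Fin k, xs t p.1 p.2 ^ 2 ≤ b ^ 2 := fun p => by
    rw [sq_le_sq]
    exact ((PiLp.norm_apply_le (xs t p.1) p.2).trans (hxs t p.1)).trans (le_abs_self b)
  have hE := abs_le.1 (he.abs_integral_mul_le hσ t p q)
  have h1 := hx p
  have h2 := hx q
  unfold crossDev
  set x := xs t p.1 p.2
  set y := xs t q.1 q.2
  set u := e t p.1 ω p.2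
  set v := e t q.1 ω q.2
  rw [abs_le]
  constructor
  · nlinarith [sq_nonneg (x + v), sq_nonneg (y + u), sq_nonneg (u + v)]
  · nlinarith [sq_nonneg (x - v), sq_nonneg (y - u), sq_nonneg (u - v)]

theorem IsNoise.exp_crossDev (he : IsNoise μ σ e) (hσ : 0 < σ) {xs : Fin T → Fin n → Vec k}
    (hxs : ∀ t i, ‖xs t i‖ ≤ b) (p q : Fin n × Fin k) (t : Fin T) :
    Integrable (fun ω => Real.exp (1 / (8 * σ ^ 2) * |crossDev μ xs e p q t ω|)) μ ∧
    ∫ ω, Real.exp (1 / (8 * σ ^ 2) * |crossDev μ xs e p q t ω|) ∂μ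
      ≤ 2 * Real.exp (1 / (8 * σ ^ 2) * (b ^ 2 + 2 * σ ^ 2)) := by
  have ip := integrable_exp_sq_of_subgaussian hσ (he.subgaussian t p.1 p.2)
    (he.measurable t p.1 p.2)
  have iq := integrable_exp_sq_of_subgaussian hσ (he.subgaussian t q.1 q.2)
    (he.measurable t q.1 q.2)
  have bp := integral_exp_sq_le_of_subgaussian hσ (he.subgaussian t p.1 p.2)
    (he.measurable t p.1 p.2)
  have bq := integral_exp_sq_le_of_subgaussian hσ (he.subgaussian t q.1 q.2)
    (he.measurable t q.1 q.2)
  set c := Real.exp (1 / (8 * σ ^ 2) * (b ^ 2 + 2 * σ ^ 2)) with hc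
  have hpt : ∀ ω, Real.exp (1 / (8 * σ ^ 2) * |crossDev μ xs e p q t ω|)
      ≤ c / 2 * (Real.exp (e t p.1 ω p.2 ^ 2 / (4 * σ ^ 2))
        + Real.exp (e t q.1 ω q.2 ^ 2 / (4 * σ ^ 2))) := by
    intro ω
    have h1 : Real.exp (1 / (8 * σ ^ 2) * |crossDev μ xs e p q t ω|)
        ≤ c * (Real.exp (e t p.1 ω p.2 ^ 2 / (8 * σ ^ 2))
          * Real.exp (e t q.1 ω q.2 ^ 2 / (8 * σ ^ 2))) := by
      rw [hc, ← Real.exp_add, ← Real.exp_add]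
      apply Real.exp_le_exp.2
      have := mul_le_mul_of_nonneg_left (he.abs_crossDev_le hσ hxs p q t ω)
        (show 0 ≤ 1 / (8 * σ ^ 2) by positivity)
      refine this.trans (le_of_eq ?_)
      ring
    have h2 : ∀ x : ℝ, Real.exp (x / (4 * σ ^ 2)) = Real.exp (x / (8 * σ ^ 2)) ^ 2 := by
      intro x
      rw [← Real.exp_nat_mul]
      congr 1
      push_cast
      field_simp
      ring
    -- The rate `1 / (8σ²)` is half of the admissible `1 / (4σ²)`: the product of the two
    -- exponentials is at most the mean of their squares. No independence of the two coordinates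
    -- enters, so `p = q` is covered.
    rw [h2, h2]
    have h3 := two_mul_le_add_sq (Real.exp (e t p.1 ω p.2 ^ 2 / (8 * σ ^ 2)))
      (Real.exp (e t q.1 ω q.2 ^ 2 / (8 * σ ^ 2)))
    have hc0 : 0 < c := Real.exp_pos _
    nlinarith
  have hint := (ip.add iq).const_mul (c / 2)
  have hm := he.measurable_crossDev xs p q t
  have hi : Integrable (fun ω => Real.exp (1 / (8 * σ ^ 2) * |crossDev μ xs e p q t ω|)) μ := by
    refine hint.mono' (by fun_prop) (ae_of_all _ fun ω => ?_)
    rw [Real.norm_eq_abs, abs_of_pos (Real.exp_pos _)]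
    exact hpt ω
  refine ⟨hi, (integral_mono hi hint hpt).trans ?_⟩
  simp only [Pi.add_apply]
  rw [integral_const_mul, integral_add ip iq]
  have hc0 : 0 < c := Real.exp_pos _
  nlinarith

theorem IsNoise.measure_empMatrix_dev_le (he : IsNoise μ σ e) (hσ : 0 < σ) (hT : 0 < T)
    {xs : Fin T → Fin n → Vec k} (hxs : ∀ t i, ‖xs t i‖ ≤ b) {ε : ℝ} (hε : 0 ≤ ε)
    (hεσ : ε ≤ 64 * σ ^ 2) (p q : Fin n × Fin k) :
    μ.real {ω | ε ≤ |empMatrix (fun t i => xs t i + e t i ω) p q - popMatrix μ xs e p q|}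
      ≤ 2 * Real.exp (-(tailRate σ b * (T * ε ^ 2))) := by
  have hT' : (0 : ℝ) < T := by exact_mod_cast hT
  have hset : {ω | ε ≤ |empMatrix (fun t i => xs t i + e t i ω) p q - popMatrix μ xs e p q|}
      = {ω | T * ε ≤ |∑ t, crossDev μ xs e p q t ω|} := by
    ext ω
    simp only [Set.mem_ofPred_eq]
    rw [empMatrix_sub_popMatrix, abs_mul, abs_of_pos (by positivity), one_div,
      le_inv_mul_iff₀ hT']
  rw [hset]
  -- `tailRate` is `θ² / (32 M)` for this `θ` and the `M` of `exp_crossDev`; the range `ε ≤ 64σ²` is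
  -- `ε ≤ 8 / θ`.
  refine measure_abs_sum_ge_le_of_exp_abs (θ := 1 / (8 * σ ^ 2)) (by positivity) ?_ hε ?_
    (he.iIndepFun_crossDev xs p q) (he.measurable_crossDev xs p q)
    (fun t => (he.exp_crossDev hσ hxs p q t).1) (fun t => (he.exp_crossDev hσ hxs p q t).2)
    (he.integral_crossDev xs p q)
  · have : 1 ≤ Real.exp (1 / (8 * σ ^ 2) * (b ^ 2 + 2 * σ ^ 2)) :=
      Real.one_le_exp (by positivity)
    linarith
  · refine hεσ.trans (le_of_eq ?_)
    field_simp
    norm_num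

theorem IsNoise.measure_exists_empMatrix_dev_le (he : IsNoise μ σ e) (hσ : 0 < σ) (hT : 0 < T)
    {xs : Fin T → Fin n → Vec k} (hxs : ∀ t i, ‖xs t i‖ ≤ b) {ε : ℝ} (hε : 0 ≤ ε)
    (hεσ : ε ≤ 64 * σ ^ 2) :
    μ.real {ω | ∃ p q,
        ε ≤ |empMatrix (fun t i => xs t i + e t i ω) p q - popMatrix μ xs e p q|}
      ≤ 2 * (n * k) ^ 2 * Real.exp (-(tailRate σ b * (T * ε ^ 2))) := by
  have hset : {ω | ∃ p q,
        ε ≤ |empMatrix (fun t i => xs t i + e t i ω) p q - popMatrix μ xs e p q|}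
      = ⋃ r : (Fin n × Fin k) × (Fin n × Fin k),
        {ω | ε ≤ |empMatrix (fun t i => xs t i + e t i ω) r.1 r.2 - popMatrix μ xs e r.1 r.2|} := by
    ext ω
    simp only [Set.mem_ofPred_eq, Set.mem_iUnion, Prod.exists]
  rw [hset]
  refine (measureReal_iUnion_fintype_le _).trans
    ((Finset.sum_le_sum fun r _ => he.measure_empMatrix_dev_le hσ hT hxs hε hεσ r.1 r.2).trans
      (le_of_eq ?_))
  simp only [Finset.sum_const, Finset.card_univ, Fintype.card_prod, Fintype.card_fin,
    nsmul_eq_mul]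
  push_cast
  ring

end

/-! ### Frobenius norm and entrywise inner product. -/

open scoped Matrix.Norms.Frobenius

/-- The entrywise inner product of matrices. -/
def frobInner {k : ℕ} (A B : Matrix (Fin k) (Fin k) ℝ) : ℝ := ∑ a, ∑ c, A a c * B a c

/-- The block of a matrix indexed by a pair of players. -/
def block {n k : ℕ} (M : Matrix (Fin n × Fin k) (Fin n × Fin k) ℝ) (l j : Fin n) :
    Matrix (Fin k) (Fin k) ℝ := fun a c => M (l, a) (j, c)

section

variable {k : ℕ}

theorem frob_eq_norm (M : Matrix (Fin k) (Fin k) ℝ) : frob M = ‖M‖ := by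
  simp [frob, Matrix.frobenius_norm_def, Real.sqrt_eq_rpow]

theorem frobenius_norm_sq (M : Matrix (Fin k) (Fin k) ℝ) : ‖M‖ ^ 2 = ∑ a, ∑ c, M a c ^ 2 := by
  rw [← frob_eq_norm, frob, Real.sq_sqrt (by positivity)]

theorem frobInner_self (M : Matrix (Fin k) (Fin k) ℝ) : frobInner M M = ‖M‖ ^ 2 := by
  rw [frobenius_norm_sq]
  simp only [frobInner, sq]

theorem frobInner_le (A B : Matrix (Fin k) (Fin k) ℝ) : frobInner A B ≤ ‖A‖ * ‖B‖ := by
  have h := Real.sum_mul_le_sqrt_mul_sqrt Finset.univ (fun r : Fin k × Fin k => A r.1 r.2)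
    (fun r => B r.1 r.2)
  simp only [Fintype.sum_prod_type] at h
  rwa [← frob_eq_norm, ← frob_eq_norm]

theorem frobInner_smul_right (r : ℝ) (A B : Matrix (Fin k) (Fin k) ℝ) :
    frobInner A (r • B) = r * frobInner A B := by
  simp only [frobInner, Finset.mul_sum, Matrix.smul_apply, smul_eq_mul]
  exact Finset.sum_congr rfl fun a _ => Finset.sum_congr rfl fun c _ => by ring

theorem frobInner_zero_right (A : Matrix (Fin k) (Fin k) ℝ) : frobInner A 0 = 0 := by
  simp [frobInner]

theorem frobenius_norm_le_sum_abs (M : Matrix (Fin k) (Fin k) ℝ) : ‖M‖ ≤ ∑ a, ∑ c, |M a c| := by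
  apply le_of_sq_le_sq _ (by positivity)
  rw [frobenius_norm_sq]
  have h := Finset.sum_sq_le_sq_sum_of_nonneg (s := Finset.univ)
    (f := fun r : Fin k × Fin k => |M r.1 r.2|) fun _ _ => abs_nonneg _
  simpa only [Fintype.sum_prod_type, sq_abs] using h

theorem frobenius_norm_le_of_forall_abs_le {M : Matrix (Fin k) (Fin k) ℝ} {r : ℝ} (hr : 0 ≤ r)
    (h : ∀ a c, |M a c| ≤ r) : ‖M‖ ≤ k * r := by
  apply le_of_sq_le_sq _ (by positivity)
  rw [frobenius_norm_sq]
  have h1 : ∑ a, ∑ c, M a c ^ 2 ≤ ∑ _a : Fin k, ∑ _c : Fin k, r ^ 2 :=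
    Finset.sum_le_sum fun a _ => Finset.sum_le_sum fun c _ => sq_le_sq' (abs_le.1 (h a c)).1
      (abs_le.1 (h a c)).2
  refine h1.trans (le_of_eq ?_)
  simp
  ring

theorem norm_act_le (M : Matrix (Fin k) (Fin k) ℝ) (v : Vec k) : ‖act M v‖ ≤ ‖M‖ * ‖v‖ := by
  apply le_of_sq_le_sq _ (by positivity)
  rw [mul_pow, frobenius_norm_sq, EuclideanSpace.real_norm_sq_eq, EuclideanSpace.real_norm_sq_eq,
    Finset.sum_mul]
  refine Finset.sum_le_sum fun a _ => ?_
  simpa [act, Matrix.mulVec, dotProduct] using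
    Finset.sum_mul_sq_le_sq_mul_sq Finset.univ (M a) v.ofLp

theorem act_add (M N : Matrix (Fin k) (Fin k) ℝ) (v : Vec k) :
    act (M + N) v = act M v + act N v := by
  simp [act, Matrix.add_mulVec]

theorem act_smul (r : ℝ) (M : Matrix (Fin k) (Fin k) ℝ) (v : Vec k) :
    act (r • M) v = r • act M v := by
  simp [act, Matrix.smul_mulVec]

theorem act_zero (v : Vec k) : act (0 : Matrix (Fin k) (Fin k) ℝ) v = 0 := by
  simp [act]

end

/-! ### Deterministic error bound and dual feasibility. -/

section Deterministic

variable {n k : ℕ} {S : Finset (Fin n)} {B H : Fin n → Fin n → Matrix (Fin k) (Fin k) ℝ}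
  {D N R : Fin n → Matrix (Fin k) (Fin k) ℝ} {c κ ν lam α : ℝ}

theorem sum_norm_le_sqrt_card_mul (D : Fin n → Matrix (Fin k) (Fin k) ℝ) :
    ∑ l ∈ S, ‖D l‖ ≤ √S.card * √(∑ l ∈ S, ‖D l‖ ^ 2) := by
  have h := Real.sum_mul_le_sqrt_mul_sqrt S (fun _ => (1 : ℝ)) (fun l => ‖D l‖)
  simpa using h

theorem norm_sum_mul_sub_le (hE : ∀ l j, ‖B l j - H l j‖ ≤ κ) (hκ : 0 ≤ κ) (j : Fin n) :
    ‖∑ l ∈ S, D l * (B l j - H l j)‖ ≤ κ * √S.card * √(∑ l ∈ S, ‖D l‖ ^ 2) := by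
  calc ‖∑ l ∈ S, D l * (B l j - H l j)‖ ≤ ∑ l ∈ S, ‖D l * (B l j - H l j)‖ := norm_sum_le _ _
    _ ≤ ∑ l ∈ S, ‖D l‖ * κ := Finset.sum_le_sum fun l _ =>
        (Matrix.frobenius_norm_mul _ _).trans (by gcongr; exact hE l j)
    _ = κ * ∑ l ∈ S, ‖D l‖ := by rw [← Finset.sum_mul, mul_comm]
    _ ≤ κ * (√S.card * √(∑ l ∈ S, ‖D l‖ ^ 2)) := by
        gcongr
        exact sum_norm_le_sqrt_card_mul D
    _ = _ := by ring

theorem sum_mul_eq_sub (hRN : ∀ j, R j = N j - ∑ l ∈ S, D l * B l j) (j : Fin n) :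
    ∑ l ∈ S, D l * H l j = N j - R j - ∑ l ∈ S, D l * (B l j - H l j) := by
  rw [hRN]
  simp only [mul_sub, Finset.sum_sub_distrib]
  abel

/-- The error of an approximately stationary point. -/
theorem sqrt_sum_norm_sq_le (hc : 0 < c) (hE : ∀ l j, ‖B l j - H l j‖ ≤ κ) (hκ : 0 ≤ κ)
    (hcoer : c * ∑ l ∈ S, ‖D l‖ ^ 2 ≤ ∑ j ∈ S, frobInner (∑ l ∈ S, D l * H l j) (D j))
    (hRN : ∀ j, R j = N j - ∑ l ∈ S, D l * B l j) (hN : ∀ j ∈ S, ‖N j‖ ≤ ν)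
    (hR : ∀ j ∈ S, ‖R j‖ ≤ lam / 2) (hν : 0 ≤ ν) (hlam : 0 ≤ lam) (hκc : κ * S.card ≤ c / 2) :
    √(∑ l ∈ S, ‖D l‖ ^ 2) ≤ 2 / c * (√S.card * (ν + lam / 2)) := by
  set d := √(∑ l ∈ S, ‖D l‖ ^ 2) with hd
  have hd2 : d ^ 2 = ∑ l ∈ S, ‖D l‖ ^ 2 := Real.sq_sqrt (by positivity)
  have hd0 : 0 ≤ d := Real.sqrt_nonneg _
  have h1 : ∑ j ∈ S, frobInner (∑ l ∈ S, D l * H l j) (D j)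
      ≤ ∑ j ∈ S, (ν + lam / 2 + κ * √S.card * d) * ‖D j‖ := by
    refine Finset.sum_le_sum fun j hj => (frobInner_le _ _).trans ?_
    gcongr
    rw [sum_mul_eq_sub hRN]
    refine (norm_sub_le _ _).trans (add_le_add ((norm_sub_le _ _).trans
      (add_le_add (hN j hj) (hR j hj))) (norm_sum_mul_sub_le hE hκ j))
  rw [← Finset.mul_sum] at h1
  have h2 : (ν + lam / 2 + κ * √S.card * d) * ∑ j ∈ S, ‖D j‖
      ≤ (ν + lam / 2 + κ * √S.card * d) * (√S.card * d) := by
    gcongr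
    exact sum_norm_le_sqrt_card_mul D
  have hs : √(S.card : ℝ) * √S.card = S.card := Real.mul_self_sqrt (by positivity)
  have h3 : c * d ^ 2 ≤ √S.card * (ν + lam / 2) * d + κ * S.card * d ^ 2 := by
    rw [← hd2] at hcoer
    -- Coercivity against Cauchy–Schwarz. The contribution of `B - H` is quadratic in `d` with
    -- coefficient `κ * S.card ≤ c / 2`, so half of the left-hand side absorbs it.
    calc _ ≤ _ := hcoer.trans (h1.trans h2)
      _ = √S.card * (ν + lam / 2) * d + κ * (√S.card * √S.card) * d ^ 2 := by ring
      _ = _ := by rw [hs]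
  have h4 : κ * S.card * d ^ 2 ≤ c / 2 * d ^ 2 := by gcongr
  rcases hd0.eq_or_lt with h0 | h0
  · rw [← h0]; positivity
  · have h5 : c / 2 * d ≤ √S.card * (ν + lam / 2) := by
      have : (c / 2 * d) * d ≤ (√S.card * (ν + lam / 2)) * d := by nlinarith
      exact le_of_mul_le_mul_right this h0
    calc d = 2 / c * (c / 2 * d) := by field_simp
      _ ≤ _ := by gcongr

/-- Strict dual feasibility outside the support. -/
theorem norm_lt_of_incoherent (hc : 0 < c) (hE : ∀ l j, ‖B l j - H l j‖ ≤ κ) (hκ : 0 ≤ κ)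
    (hcoer : c * ∑ l ∈ S, ‖D l‖ ^ 2 ≤ ∑ j ∈ S, frobInner (∑ l ∈ S, D l * H l j) (D j))
    (hRN : ∀ j, R j = N j - ∑ l ∈ S, D l * B l j) (hN : ∀ j ∈ S, ‖N j‖ ≤ ν)
    (hR : ∀ j ∈ S, ‖R j‖ ≤ lam / 2) (hν : 0 ≤ ν) (hlam : 0 < lam)
    (hα : 0 < α) (hα1 : α ≤ 1) (hκα : κ * S.card ≤ c * α / 32) (hνα : ν ≤ α * lam / 8)
    {j : Fin n} (hNj : ‖N j‖ ≤ ν) {Q : Fin n → Matrix (Fin k) (Fin k) ℝ}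
    (hQ : ∀ l ∈ S, H l j = ∑ m ∈ S, H l m * Q m) (hQα : ∑ m ∈ S, ‖Q m‖ ≤ 1 - α) :
    ‖R j‖ < lam / 2 := by
  have hd := sqrt_sum_norm_sq_le hc hE hκ hcoer hRN hN hR hν hlam.le
    (hκα.trans (by nlinarith))
  set d := √(∑ l ∈ S, ‖D l‖ ^ 2) with hd'
  have hs : √(S.card : ℝ) * √S.card = S.card := Real.mul_self_sqrt (by positivity)
  -- Insert the error bound for `d`; the factor is `(c α / 32) * (2 / c) = α / 16`.
  have hη : ∀ j, ‖∑ l ∈ S, D l * (B l j - H l j)‖ ≤ α / 16 * (ν + lam / 2) := by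
    intro j
    refine (norm_sum_mul_sub_le hE hκ j).trans ?_
    rw [← hd']
    calc κ * √S.card * d ≤ κ * √S.card * (2 / c * (√S.card * (ν + lam / 2))) := by gcongr
      _ = κ * (√S.card * √S.card) * (2 / c) * (ν + lam / 2) := by ring
      _ = κ * S.card * (2 / c) * (ν + lam / 2) := by rw [hs]
      _ ≤ c * α / 32 * (2 / c) * (ν + lam / 2) := by gcongr
      _ = _ := by field_simp; norm_num
  have hDH : ∀ m ∈ S, ‖∑ l ∈ S, D l * H l m‖ ≤ (1 + α / 16) * (ν + lam / 2) := by
    intro m hm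
    rw [sum_mul_eq_sub hRN]
    refine (norm_sub_le _ _).trans ?_
    have h1 := norm_sub_le (N m) (R m)
    have h2 := hN m hm
    have h3 := hR m hm
    have h4 := hη m
    linarith
  -- The incoherence step: column `j` of `H` on `S` is a combination of the columns in `S`, with
  -- coefficients of total norm at most `1 - α`. What holds on `S` is transferred to `j` with that
  -- factor.
  have hsum : ∑ l ∈ S, D l * H l j = ∑ m ∈ S, (∑ l ∈ S, D l * H l m) * Q m := by
    simp_rw [Finset.sum_mul, mul_assoc]
    rw [Finset.sum_comm]
    refine Finset.sum_congr rfl fun l hl => ?_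
    rw [hQ l hl, Finset.mul_sum]
  have hj : ‖∑ l ∈ S, D l * H l j‖ ≤ (1 + α / 16) * (ν + lam / 2) * (1 - α) := by
    rw [hsum]
    calc _ ≤ ∑ m ∈ S, ‖(∑ l ∈ S, D l * H l m) * Q m‖ := norm_sum_le _ _
      _ ≤ ∑ m ∈ S, (1 + α / 16) * (ν + lam / 2) * ‖Q m‖ := Finset.sum_le_sum fun m hm =>
          (Matrix.frobenius_norm_mul _ _).trans (by gcongr; exact hDH m hm)
      _ = (1 + α / 16) * (ν + lam / 2) * ∑ m ∈ S, ‖Q m‖ := by rw [Finset.mul_sum]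
      _ ≤ _ := by gcongr
  have hRj : R j = N j - ∑ l ∈ S, D l * H l j - ∑ l ∈ S, D l * (B l j - H l j) := by
    rw [sum_mul_eq_sub hRN]
    abel
  rw [hRj]
  have h1 := norm_sub_le (N j - ∑ l ∈ S, D l * H l j) (∑ l ∈ S, D l * (B l j - H l j))
  have h2 := norm_sub_le (N j) (∑ l ∈ S, D l * H l j)
  have h3 := hη j
  -- The incoherence gain lowers `lam / 2` by `7αlam / 16`, whereas the two contributions of `ν`
  -- cost at most `αlam / 4`.
  have h4 : α / 16 + (1 + α / 16) * (1 - α) ≤ 1 - 7 / 8 * α := by nlinarith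
  have h5 : (α / 16 + (1 + α / 16) * (1 - α)) * (ν + lam / 2)
      ≤ (1 - 7 / 8 * α) * (α * lam / 8 + lam / 2) := by
    have : 0 ≤ 1 - 7 / 8 * α := by linarith
    gcongr
  have h6 : 0 < α * lam := by positivity
  have h7 : 0 ≤ α * (α * lam) := by positivity
  nlinarith

end Deterministic

/-! ### The penalized least-squares problem and its optimality conditions. -/

section

variable {n k T : ℕ}

/-- The prediction of player `i`'s action from the actions of the others. -/
def predict (X : Fin T → Fin n → Vec k) (i : Fin n) (V : Fin n → Matrix (Fin k) (Fin k) ℝ)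
    (t : Fin T) : Vec k :=
  ∑ j ∈ Finset.univ.erase i, act (V j) (X t j)

theorem predict_add (X : Fin T → Fin n → Vec k) (i : Fin n)
    (V G : Fin n → Matrix (Fin k) (Fin k) ℝ) (t : Fin T) :
    predict X i (V + G) t = predict X i V t + predict X i G t := by
  simp [predict, act_add, Finset.sum_add_distrib]

theorem predict_smul (X : Fin T → Fin n → Vec k) (i : Fin n) (r : ℝ)
    (G : Fin n → Matrix (Fin k) (Fin k) ℝ) (t : Fin T) :
    predict X i (r • G) t = r • predict X i G t := by
  simp only [predict, Pi.smul_apply, act_smul, Finset.smul_sum]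

theorem objective_eq (lam : ℝ) (X : Fin T → Fin n → Vec k) (i : Fin n)
    (V : Fin n → Matrix (Fin k) (Fin k) ℝ) :
    objective lam X i V = (1 / (T : ℝ)) * ∑ t, ‖X t i - predict X i V t‖ ^ 2
      + lam * ∑ j ∈ Finset.univ.erase i, ‖V j‖ := by
  simp only [objective, predict, frob_eq_norm]

/-- The negative of half the gradient of the quadratic part of the objective. -/
def resid (X : Fin T → Fin n → Vec k) (i : Fin n) (V : Fin n → Matrix (Fin k) (Fin k) ℝ)
    (j : Fin n) : Matrix (Fin k) (Fin k) ℝ :=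
  block (empMatrix X) i j - ∑ l ∈ Finset.univ.erase i, V l * block (empMatrix X) l j

theorem resid_apply (X : Fin T → Fin n → Vec k) (i : Fin n)
    (V : Fin n → Matrix (Fin k) (Fin k) ℝ) (j : Fin n) (a c : Fin k) :
    resid X i V j a c = (1 / (T : ℝ)) * ∑ t, (X t i - predict X i V t) a * X t j c := by
  have h : ∀ l, (V l * block (empMatrix X) l j) a c
      = (1 / (T : ℝ)) * ∑ t, act (V l) (X t l) a * X t j c := by
    intro l
    simp only [Matrix.mul_apply, block, empMatrix, Matrix.of_apply, act, Matrix.mulVec,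
      dotProduct, Finset.mul_sum, Finset.sum_mul]
    rw [Finset.sum_comm]
    exact Finset.sum_congr rfl fun t _ => Finset.sum_congr rfl fun a' _ => by ring
  have h2 : resid X i V j a c = block (empMatrix X) i j a c
      - ∑ l ∈ Finset.univ.erase i, (V l * block (empMatrix X) l j) a c := by
    simp [resid, Matrix.sum_apply]
  rw [h2]
  simp_rw [h]
  rw [← Finset.mul_sum, Finset.sum_comm]
  simp only [block, empMatrix, Matrix.of_apply]
  rw [← mul_sub, ← Finset.sum_sub_distrib]
  congr 1
  refine Finset.sum_congr rfl fun t _ => ?_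
  rw [← Finset.sum_mul, ← sub_mul]
  simp [predict]

/-- This identifies `resid` as the gradient term: it represents the linear form in `G` that appears
when the square is expanded. -/
theorem sum_inner_predict (X : Fin T → Fin n → Vec k) (i : Fin n)
    (V G : Fin n → Matrix (Fin k) (Fin k) ℝ) :
    (1 / (T : ℝ)) * ∑ t, inner ℝ (X t i - predict X i V t) (predict X i G t)
      = ∑ j ∈ Finset.univ.erase i, frobInner (resid X i V j) (G j) := by
  have h : ∀ (r : Vec k) (M : Matrix (Fin k) (Fin k) ℝ) (v : Vec k),
      inner ℝ r (act M v) = ∑ a, ∑ c, r a * v c * M a c := by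
    intro r M v
    simp only [PiLp.inner_apply, act, Matrix.mulVec, dotProduct, RCLike.inner_apply,
      conj_trivial, Finset.sum_mul]
    exact Finset.sum_congr rfl fun a _ => Finset.sum_congr rfl fun c _ => by ring
  have h' : ∀ t, inner ℝ (X t i - predict X i V t) (predict X i G t)
      = ∑ j ∈ Finset.univ.erase i, ∑ a, ∑ c,
        (X t i - predict X i V t) a * X t j c * G j a c := by
    intro t
    rw [show predict X i G t = ∑ j ∈ Finset.univ.erase i, act (G j) (X t j) from rfl, inner_sum]
    exact Finset.sum_congr rfl fun j _ => h _ _ _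
  simp_rw [h']
  rw [Finset.sum_comm, Finset.mul_sum]
  refine Finset.sum_congr rfl fun j _ => ?_
  simp only [frobInner, resid_apply]
  rw [Finset.sum_comm, Finset.mul_sum]
  refine Finset.sum_congr rfl fun a _ => ?_
  rw [Finset.sum_comm, Finset.mul_sum]
  refine Finset.sum_congr rfl fun c _ => ?_
  rw [mul_assoc, Finset.sum_mul]

theorem objective_add (lam : ℝ) (X : Fin T → Fin n → Vec k) (i : Fin n)
    (V G : Fin n → Matrix (Fin k) (Fin k) ℝ) :
    objective lam X i (V + G) = objective lam X i V
      - 2 * ∑ j ∈ Finset.univ.erase i, frobInner (resid X i V j) (G j)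
      + (1 / (T : ℝ)) * ∑ t, ‖predict X i G t‖ ^ 2
      + lam * ∑ j ∈ Finset.univ.erase i, (‖V j + G j‖ - ‖V j‖) := by
  rw [objective_eq, objective_eq, ← sum_inner_predict]
  have h : ∀ t, ‖X t i - predict X i (V + G) t‖ ^ 2 = ‖X t i - predict X i V t‖ ^ 2
      - 2 * inner ℝ (X t i - predict X i V t) (predict X i G t) + ‖predict X i G t‖ ^ 2 := by
    intro t
    rw [predict_add, ← sub_sub, norm_sub_sq_real]
  simp_rw [h]
  rw [Finset.sum_add_distrib, Finset.sum_sub_distrib, Finset.sum_sub_distrib, ← Finset.mul_sum]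
  simp only [Pi.add_apply]
  ring

/-- `V` minimizes the objective of player `i` among the families supported on `S`. -/
def IsSupportedMin (lam : ℝ) (X : Fin T → Fin n → Vec k) (i : Fin n) (S : Finset (Fin n))
    (V : Fin n → Matrix (Fin k) (Fin k) ℝ) : Prop :=
  (∀ j ∉ S, V j = 0) ∧
    ∀ V', (∀ j ∉ S, V' j = 0) → objective lam X i V ≤ objective lam X i V'

theorem nonneg_of_forall_mul_add_sq_mul_nonneg {a q : ℝ}
    (h : ∀ r : ℝ, 0 < r → r ≤ 1 → 0 ≤ r * a + r ^ 2 * q) :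
    0 ≤ a := by
  by_contra! ha
  have hq : 0 < |q| + 1 := by positivity
  -- Small enough that the quadratic term is at most half of `|r * a|`; the `+ 1` covers `q = 0`.
  set r := min 1 (-a / (2 * (|q| + 1))) with hr
  have hr0 : 0 < r := lt_min one_pos (div_pos (by linarith) (by positivity))
  have h1 := h r hr0 (min_le_left _ _)
  have h2 : r * (2 * (|q| + 1)) ≤ -a := by
    rw [← le_div_iff₀ (by positivity)]
    exact min_le_right _ _
  have h3 : 0 ≤ a + r * q := by
    have : 0 ≤ r * (a + r * q) := by nlinarith
    exact nonneg_of_mul_nonneg_right this hr0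
  have h4 : r * q ≤ r * |q| := by gcongr; exact le_abs_self q
  nlinarith

/-- First-order optimality without subgradients: move by `r • G`, bound the penalty by convexity,
divide by `r` and let `r` tend to zero. -/
theorem IsSupportedMin.variational {lam : ℝ} {X : Fin T → Fin n → Vec k} {i : Fin n}
    {S : Finset (Fin n)} {V : Fin n → Matrix (Fin k) (Fin k) ℝ}
    (hV : IsSupportedMin lam X i S V) (hlam : 0 ≤ lam)
    {G : Fin n → Matrix (Fin k) (Fin k) ℝ} (hG : ∀ j ∉ S, G j = 0) :
    0 ≤ -2 * ∑ j ∈ Finset.univ.erase i, frobInner (resid X i V j) (G j)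
      + lam * ∑ j ∈ Finset.univ.erase i, (‖V j + G j‖ - ‖V j‖) := by
  refine nonneg_of_forall_mul_add_sq_mul_nonneg
    (q := (1 / (T : ℝ)) * ∑ t, ‖predict X i G t‖ ^ 2) fun r hr hr1 => ?_
  have h := hV.2 (V + r • G) fun j hj => by simp [hV.1 j hj, hG j hj]
  rw [objective_add] at h
  have h1 : ∑ j ∈ Finset.univ.erase i, (‖V j + (r • G) j‖ - ‖V j‖)
      ≤ r * ∑ j ∈ Finset.univ.erase i, (‖V j + G j‖ - ‖V j‖) := by
    rw [Finset.mul_sum]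
    refine Finset.sum_le_sum fun j _ => ?_
    have h2 : V j + (r • G) j = (1 - r) • V j + r • (V j + G j) := by
      rw [Pi.smul_apply]
      module
    have h3 := norm_add_le ((1 - r) • V j) (r • (V j + G j))
    rw [norm_smul, norm_smul, Real.norm_of_nonneg hr.le, Real.norm_of_nonneg (by linarith)] at h3
    rw [h2]
    linarith
  have h2 : ∑ t, ‖predict X i (r • G) t‖ ^ 2 = r ^ 2 * ∑ t, ‖predict X i G t‖ ^ 2 := by
    rw [Finset.mul_sum]
    refine Finset.sum_congr rfl fun t _ => ?_
    rw [predict_smul, norm_smul, mul_pow, Real.norm_of_nonneg hr.le]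
  have h3 : ∑ j ∈ Finset.univ.erase i, frobInner (resid X i V j) ((r • G) j)
      = r * ∑ j ∈ Finset.univ.erase i, frobInner (resid X i V j) (G j) := by
    rw [Finset.mul_sum]
    exact Finset.sum_congr rfl fun j _ => frobInner_smul_right _ _ _
  rw [h2, h3] at h
  have h4 := mul_le_mul_of_nonneg_left h1 hlam
  linarith

/-- Test the variational inequality with the residual itself in block `j`: `2‖R j‖² ≤ lam * ‖R j‖`.
-/
theorem IsSupportedMin.norm_resid_le {lam : ℝ} {X : Fin T → Fin n → Vec k} {i : Fin n}
    {S : Finset (Fin n)} {V : Fin n → Matrix (Fin k) (Fin k) ℝ}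
    (hV : IsSupportedMin lam X i S V) (hlam : 0 ≤ lam) (hS : i ∉ S) {j : Fin n} (hj : j ∈ S) :
    ‖resid X i V j‖ ≤ lam / 2 := by
  have hji : j ∈ Finset.univ.erase i :=
    Finset.mem_erase.2 ⟨fun h => hS (h ▸ hj), Finset.mem_univ _⟩
  have h := hV.variational hlam (G := Pi.single j (resid X i V j)) fun l hl =>
    Pi.single_eq_of_ne (fun h : l = j => hl (h ▸ hj)) _
  rw [Finset.sum_eq_single_of_mem j hji, Finset.sum_eq_single_of_mem j hji] at h
  · simp only [Pi.single_eq_same, frobInner_self] at h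
    have h1 := norm_add_le (V j) (resid X i V j)
    have h2 : lam * (‖V j + resid X i V j‖ - ‖V j‖) ≤ lam * ‖resid X i V j‖ := by
      gcongr
      linarith
    rcases (norm_nonneg (resid X i V j)).eq_or_lt with h0 | h0
    · rw [← h0]; linarith
    · have : 2 * ‖resid X i V j‖ * ‖resid X i V j‖ ≤ lam * ‖resid X i V j‖ := by nlinarith
      have := le_of_mul_le_mul_right this h0
      linarith
  · intro l _ hl
    simp [Pi.single_eq_of_ne hl]
  · intro l _ hl
    simp [Pi.single_eq_of_ne hl, frobInner_zero_right]

/-- In the exact expansion at `V`, the nonnegative quadratic term is dropped, the blocks in `S` are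
handled by the variational inequality, and those outside by Cauchy–Schwarz. The remaining slack
shows that leaving `S` is costly. -/
theorem IsSupportedMin.objective_add_le {lam : ℝ} {X : Fin T → Fin n → Vec k} {i : Fin n}
    {S : Finset (Fin n)} {V : Fin n → Matrix (Fin k) (Fin k) ℝ}
    (hV : IsSupportedMin lam X i S V) (hlam : 0 ≤ lam) (hS : i ∉ S)
    (V' : Fin n → Matrix (Fin k) (Fin k) ℝ) :
    objective lam X i V
        + ∑ j ∈ Finset.univ.erase i \ S, (lam - 2 * ‖resid X i V j‖) * ‖V' j‖
      ≤ objective lam X i V' := by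
  have hSE : S ⊆ Finset.univ.erase i := fun j hj =>
    Finset.mem_erase.2 ⟨fun h => hS (h ▸ hj), Finset.mem_univ _⟩
  have hsplit : ∀ f : Fin n → ℝ, ∑ j ∈ Finset.univ.erase i, f j
      = ∑ j ∈ Finset.univ.erase i \ S, f j + ∑ j ∈ S, f j := fun f =>
    (Finset.sum_sdiff hSE).symm
  have hobj := objective_add lam X i V (V' - V)
  have hvar := hV.variational hlam (G := fun j => if j ∈ S then V' j - V j else 0)
    fun j hj => if_neg hj
  rw [add_sub_cancel] at hobj
  rw [hobj]
  have hq : 0 ≤ (1 / (T : ℝ)) * ∑ t, ‖predict X i (V' - V) t‖ ^ 2 := by positivity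
  simp only [Pi.sub_apply, add_sub_cancel]
  rw [hsplit] at hvar
  rw [hsplit (fun j => ‖V j + if j ∈ S then V' j - V j else 0‖ - ‖V j‖)] at hvar
  have z1 : ∑ j ∈ Finset.univ.erase i \ S,
      frobInner (resid X i V j) (if j ∈ S then V' j - V j else 0) = 0 :=
    Finset.sum_eq_zero fun j hj => by
      rw [if_neg (Finset.mem_sdiff.1 hj).2, frobInner_zero_right]
  have z2 : ∑ j ∈ Finset.univ.erase i \ S,
      (‖V j + if j ∈ S then V' j - V j else 0‖ - ‖V j‖) = 0 :=
    Finset.sum_eq_zero fun j hj => by simp [(Finset.mem_sdiff.1 hj).2]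
  have z3 : ∑ j ∈ S, frobInner (resid X i V j) (if j ∈ S then V' j - V j else 0)
      = ∑ j ∈ S, frobInner (resid X i V j) (V' j - V j) :=
    Finset.sum_congr rfl fun j hj => by rw [if_pos hj]
  have z4 : ∑ j ∈ S, (‖V j + if j ∈ S then V' j - V j else 0‖ - ‖V j‖)
      = ∑ j ∈ S, (‖V' j‖ - ‖V j‖) :=
    Finset.sum_congr rfl fun j hj => by rw [if_pos hj, add_sub_cancel]
  rw [z1, z2, z3, z4] at hvar
  rw [hsplit (fun j => frobInner (resid X i V j) (V' j - V j)),
    hsplit (fun j => ‖V' j‖ - ‖V j‖)]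
  have hoff : ∑ j ∈ Finset.univ.erase i \ S, (lam - 2 * ‖resid X i V j‖) * ‖V' j‖
      ≤ -2 * ∑ j ∈ Finset.univ.erase i \ S, frobInner (resid X i V j) (V' j - V j)
        + lam * ∑ j ∈ Finset.univ.erase i \ S, (‖V' j‖ - ‖V j‖) := by
    rw [Finset.mul_sum, Finset.mul_sum, ← Finset.sum_add_distrib]
    refine Finset.sum_le_sum fun j hj => ?_
    rw [hV.1 j (Finset.mem_sdiff.1 hj).2, sub_zero, norm_zero, sub_zero]
    have := frobInner_le (resid X i V j) (V' j)
    linarith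
  linarith

/-- The penalty alone is coercive in the blocks other than `i`. Block `i` does not enter the
objective, and `i ∉ S` fixes it to zero, so a closed ball suffices. -/
theorem exists_isSupportedMin {lam : ℝ} (hlam : 0 < lam) (X : Fin T → Fin n → Vec k) (i : Fin n)
    {S : Finset (Fin n)} (hS : i ∉ S) : ∃ V, IsSupportedMin lam X i S V := by
  set m := objective lam X i 0 / lam with hm
  have hnn : ∀ V, lam * ∑ j ∈ Finset.univ.erase i, ‖V j‖ ≤ objective lam X i V := fun V => by
    rw [objective_eq]
    have : 0 ≤ (1 / (T : ℝ)) * ∑ t, ‖X t i - predict X i V t‖ ^ 2 := by positivity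
    linarith
  have hm0 : 0 ≤ m := by
    have h0 : 0 ≤ objective lam X i 0 := le_trans (by simp) (hnn 0)
    positivity
  have hcont : Continuous (objective lam X i) := by
    have h : ∀ t, Continuous fun V : Fin n → Matrix (Fin k) (Fin k) ℝ => predict X i V t := by
      intro t
      unfold predict act
      fun_prop
    have h' : objective lam X i = fun V => (1 / (T : ℝ)) * ∑ t, ‖X t i - predict X i V t‖ ^ 2
        + lam * ∑ j ∈ Finset.univ.erase i, ‖V j‖ := funext (objective_eq lam X i)
    rw [h']
    fun_prop
  have hcl : IsClosed {V : Fin n → Matrix (Fin k) (Fin k) ℝ | ∀ j ∉ S, V j = 0} := by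
    have : {V : Fin n → Matrix (Fin k) (Fin k) ℝ | ∀ j ∉ S, V j = 0}
        = ⋂ j, ⋂ (_ : j ∉ S), {V | V j = 0} := by
      ext V
      simp
    rw [this]
    exact isClosed_iInter fun j => isClosed_iInter fun _ =>
      isClosed_eq (continuous_apply j) continuous_const
  have : ProperSpace (Fin n → Matrix (Fin k) (Fin k) ℝ) :=
    FiniteDimensional.proper ℝ _
  have hK : IsCompact (Metric.closedBall (0 : Fin n → Matrix (Fin k) (Fin k) ℝ) m
      ∩ {V | ∀ j ∉ S, V j = 0}) := (isCompact_closedBall 0 m).inter_right hcl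
  obtain ⟨V, hVK, hV⟩ := hK.exists_isMinOn
    ⟨0, Metric.mem_closedBall_self hm0, fun _ _ => rfl⟩ hcont.continuousOn
  refine ⟨V, hVK.2, fun V' hV' => ?_⟩
  by_cases hb : V' ∈ Metric.closedBall (0 : Fin n → Matrix (Fin k) (Fin k) ℝ) m
  · exact hV ⟨hb, hV'⟩
  · have h0 : objective lam X i V ≤ objective lam X i 0 :=
      hV ⟨Metric.mem_closedBall_self hm0, fun _ _ => rfl⟩
    rw [mem_closedBall_zero_iff, pi_norm_le_iff_of_nonneg hm0] at hb
    push Not at hb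
    obtain ⟨j, hj⟩ := hb
    have hjS : j ∈ S := by
      by_contra h
      rw [hV' j h, norm_zero] at hj
      linarith
    have hji : j ∈ Finset.univ.erase i :=
      Finset.mem_erase.2 ⟨fun h => hS (h ▸ hjS), Finset.mem_univ _⟩
    have h1 : ‖V' j‖ ≤ ∑ j ∈ Finset.univ.erase i, ‖V' j‖ :=
      Finset.single_le_sum (f := fun j => ‖V' j‖) (fun _ _ => norm_nonneg _) hji
    have h2 : objective lam X i 0 < lam * ‖V' j‖ := by
      rw [hm, div_lt_iff₀ hlam] at hj
      linarith
    have h3 := hnn V'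
    have h4 := mul_le_mul_of_nonneg_left h1 hlam.le
    linarith

/-- If some minimizer over the families supported on `S` is strictly dual feasible, then the
minimizers of the objective are exactly the minimizers over the families supported on `S`. -/
theorem IsSupportedMin.isMin {lam : ℝ} {X : Fin T → Fin n → Vec k} {i : Fin n}
    {S : Finset (Fin n)} {V : Fin n → Matrix (Fin k) (Fin k) ℝ}
    (hV : IsSupportedMin lam X i S V) (hlam : 0 ≤ lam) (hS : i ∉ S)
    (hR : ∀ j, j ≠ i → j ∉ S → ‖resid X i V j‖ < lam / 2) :
    (∀ V', objective lam X i V ≤ objective lam X i V') ∧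
    ∀ V', V' i = 0 → (∀ U, objective lam X i V' ≤ objective lam X i U) →
      IsSupportedMin lam X i S V' := by
  have hpos : ∀ (V' : Fin n → Matrix (Fin k) (Fin k) ℝ), ∀ j ∈ Finset.univ.erase i \ S,
      0 ≤ (lam - 2 * ‖resid X i V j‖) * ‖V' j‖ := fun V' j hj => by
    rw [Finset.mem_sdiff, Finset.mem_erase] at hj
    have := hR j hj.1.1 hj.2
    exact mul_nonneg (by linarith) (norm_nonneg _)
  have hle := hV.objective_add_le hlam hS
  refine ⟨fun V' => ?_, fun V' hi hV' => ⟨fun j hj => ?_, fun U _ => hV' U⟩⟩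
  · have := Finset.sum_nonneg (hpos V')
    linarith [hle V']
  · rcases eq_or_ne j i with rfl | hji
    · exact hi
    have hsum : ∑ j ∈ Finset.univ.erase i \ S, (lam - 2 * ‖resid X i V j‖) * ‖V' j‖ = 0 :=
      le_antisymm (by linarith [hle V', hV' V]) (Finset.sum_nonneg (hpos V'))
    have hz := (Finset.sum_eq_zero_iff_of_nonneg (hpos V')).1 hsum j
      (Finset.mem_sdiff.2 ⟨Finset.mem_erase.2 ⟨hji, Finset.mem_univ _⟩, hj⟩)
    have := hR j hji hj
    rcases mul_eq_zero.1 hz with h | h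
    · linarith
    · exact norm_eq_zero.1 h

end

/-! ### Smallest eigenvalue and mutual incoherence in block form. -/

theorem minEigenvalue_mul_le {m : Type*} [Fintype m] [DecidableEq m] {M : Matrix m m ℝ}
    (hM : M.IsHermitian) (v : m → ℝ) :
    minEigenvalue M * ∑ p, v p ^ 2 ≤ ∑ p, v p * ∑ q, M p q * v q := by
  set c := minEigenvalue M with hc
  have hA : (M - c • (1 : Matrix m m ℝ)).IsHermitian := by
    refine hM.sub ?_
    rw [Matrix.IsHermitian, Matrix.conjTranspose_smul, Matrix.conjTranspose_one, star_trivial]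
  have hpos : (M - c • (1 : Matrix m m ℝ)).PosSemidef := by
    rw [hA.posSemidef_iff_eigenvalues_nonneg]
    intro i
    have h1 := hA.mulVec_eigenvectorBasis i
    rw [Matrix.sub_mulVec, Matrix.smul_mulVec, Matrix.one_mulVec, sub_eq_iff_eq_add,
      ← add_smul] at h1
    -- Eigenvalues of `M - c • 1` are eigenvalues of `M` shifted by `c`, hence nonnegative by the
    -- choice of `c` as an infimum over a finite set.
    have h2 : Module.End.HasEigenvalue (Matrix.toLin' M) (hA.eigenvalues i + c) := by
      refine Module.End.hasEigenvalue_of_hasEigenvector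
        (x := (hA.eigenvectorBasis i : m → ℝ)) ⟨?_, ?_⟩
      · rw [Module.End.mem_eigenspace_iff, Matrix.toLin'_apply]
        exact h1
      · intro h
        exact hA.eigenvectorBasis.orthonormal.ne_zero i (by ext p; exact congrFun h p)
    have h3 : c ≤ hA.eigenvalues i + c :=
      csInf_le (Module.End.finite_hasEigenvalue _).bddBelow h2
    simp only [Pi.zero_apply]
    linarith
  have h := hpos.dotProduct_mulVec_nonneg v
  rw [star_trivial, Matrix.sub_mulVec, Matrix.smul_mulVec, Matrix.one_mulVec, dotProduct_sub,
    dotProduct_smul, sub_nonneg] at h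
  simpa [dotProduct, Matrix.mulVec, sq] using h

section

variable {n k : ℕ} {H : Matrix (Fin n × Fin k) (Fin n × Fin k) ℝ} {W : Weights n k} {i : Fin n}

theorem blocks_isHermitian (hH : ∀ p q, H p q = H q p) (S : Finset (Fin n)) :
    (blocks H S S).IsHermitian := by
  ext p q
  simp [blocks, hH]

/-- The Rayleigh bound applied to each row of `D` separately, then summed over the rows. The
eigenvalue hypothesis is restricted to nonempty `S` because an empty matrix has `sInf ∅ = 0`. -/
theorem mul_sum_norm_sq_le {c : ℝ} (hH : ∀ p q, H p q = H q p) {S : Finset (Fin n)}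
    (hc : S.Nonempty → c ≤ minEigenvalue (blocks H S S))
    (D : Fin n → Matrix (Fin k) (Fin k) ℝ) :
    c * ∑ l ∈ S, ‖D l‖ ^ 2 ≤ ∑ j ∈ S, frobInner (∑ l ∈ S, D l * block H l j) (D j) := by
  rcases S.eq_empty_or_nonempty with rfl | hS
  · simp
  have h : ∀ a : Fin k, c * ∑ l ∈ S, ∑ a', D l a a' ^ 2
      ≤ ∑ j ∈ S, ∑ c', D j a c' * ∑ l ∈ S, ∑ a', H (j, c') (l, a') * D l a a' := by
    intro a
    have h1 := minEigenvalue_mul_le (blocks_isHermitian hH S) fun p => D p.1 a p.2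
    simp only [Fintype.sum_prod_type, blocks, Matrix.submatrix_apply] at h1
    rw [Finset.sum_coe_sort S (fun l => ∑ a', D l a a' ^ 2),
      Finset.sum_coe_sort S (fun j => ∑ c', D j a c' * ∑ l : S, ∑ a', H (j, c') (l, a') * D l a a')]
      at h1
    refine (mul_le_mul_of_nonneg_right (hc hS) (by positivity)).trans (h1.trans (le_of_eq ?_))
    refine Finset.sum_congr rfl fun j _ => Finset.sum_congr rfl fun c' _ => ?_
    rw [Finset.sum_coe_sort S (fun l => ∑ a', H (j, c') (l, a') * D l a a')]
  have hL : c * ∑ l ∈ S, ‖D l‖ ^ 2 = ∑ a, c * ∑ l ∈ S, ∑ a', D l a a' ^ 2 := by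
    simp_rw [frobenius_norm_sq]
    rw [Finset.sum_comm, Finset.mul_sum]
  have hR : ∑ j ∈ S, frobInner (∑ l ∈ S, D l * block H l j) (D j)
      = ∑ a, ∑ j ∈ S, ∑ c', D j a c' * ∑ l ∈ S, ∑ a', H (j, c') (l, a') * D l a a' := by
    simp_rw [frobInner]
    rw [Finset.sum_comm]
    refine Finset.sum_congr rfl fun a _ => Finset.sum_congr rfl fun j _ =>
      Finset.sum_congr rfl fun c' _ => ?_
    rw [mul_comm, Matrix.sum_apply]
    congr 1
    refine Finset.sum_congr rfl fun l _ => ?_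
    rw [Matrix.mul_apply]
    refine Finset.sum_congr rfl fun a' _ => ?_
    rw [block, hH, mul_comm]
  rw [hL, hR]
  exact Finset.sum_le_sum fun a _ => h a

theorem isUnit_blocks {c : ℝ} (hc : 0 < c) (hH : ∀ p q, H p q = H q p) {S : Finset (Fin n)}
    (hcS : c ≤ minEigenvalue (blocks H S S)) : IsUnit (blocks H S S).det := by
  rw [← Matrix.isUnit_iff_isUnit_det, ← Matrix.mulVec_injective_iff_isUnit]
  rw [← Matrix.coe_mulVecLin, ← LinearMap.ker_eq_bot, LinearMap.ker_eq_bot']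
  intro v hv
  have h1 := minEigenvalue_mul_le (blocks_isHermitian hH S) v
  have h2 : ∑ p, v p * ∑ q, blocks H S S p q * v q = 0 := by
    refine Finset.sum_eq_zero fun p _ => ?_
    have := congrFun hv p
    simp only [Matrix.mulVecLin_apply, Matrix.mulVec, dotProduct, Pi.zero_apply] at this
    rw [this, mul_zero]
  rw [h2] at h1
  have h3 : ∑ p, v p ^ 2 = 0 := by
    refine le_antisymm ?_ (by positivity)
    by_contra! h
    have := mul_pos (hc.trans_le hcS) h
    linarith
  ext p
  have := (Finset.sum_eq_zero_iff_of_nonneg fun p _ => sq_nonneg (v p)).1 h3 p (Finset.mem_univ p)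
  simpa using this

theorem MutualIncoherence.exists_coeff {α c : ℝ} (hI : MutualIncoherence H W i α) (hα1 : α ≤ 1)
    (hc : 0 < c) (hH : ∀ p q, H p q = H q p) (hC : (nbr W i).Nonempty → c ≤ Cmin H W i)
    {j : Fin n} (hj : j ∈ nbrCompl W i) :
    ∃ Q : Fin n → Matrix (Fin k) (Fin k) ℝ,
      (∀ l ∈ nbr W i, block H l j = ∑ m ∈ nbr W i, block H l m * Q m) ∧
      ∑ m ∈ nbr W i, ‖Q m‖ ≤ 1 - α := by
  rcases (nbr W i).eq_empty_or_nonempty with hS | hS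
  · exact ⟨0, by simp [hS], by simp [hS, hα1]⟩
  set S := nbr W i with hSdef
  set P := blocks H (nbrCompl W i) S * (blocks H S S)⁻¹ with hP
  have hPM : P * blocks H S S = blocks H (nbrCompl W i) S :=
    Matrix.nonsing_inv_mul_cancel_right _ _ (isUnit_blocks hc hH (hC hS))
  -- `Q m` is the transpose of block `(j, m)` of `P`: incoherence concerns rows of `P`, the residual
  -- equations concern columns, and `H` is symmetric.
  refine ⟨fun m => Matrix.of fun a' c' =>
    if hm : m ∈ S then P (⟨j, hj⟩, c') (⟨m, hm⟩, a') else 0, ?_, ?_⟩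
  · intro l hl
    ext a c'
    have h1 := congrFun (congrFun hPM (⟨j, hj⟩, c')) (⟨l, hl⟩, a)
    rw [Matrix.mul_apply, Fintype.sum_prod_type] at h1
    simp only [blocks, Matrix.submatrix_apply] at h1
    rw [Matrix.sum_apply, block, hH, ← h1, ← Finset.sum_coe_sort S]
    refine Finset.sum_congr rfl fun m _ => ?_
    rw [Matrix.mul_apply]
    refine Finset.sum_congr rfl fun a' _ => ?_
    simp only [Matrix.of_apply, m.2, dite_true]
    rw [block, hH, mul_comm]
  · have h1 : ∑ a, ∑ q, |P (⟨j, hj⟩, a) q| ≤ 1 - α :=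
      (le_ciSup (f := fun j : nbrCompl W i => ∑ a, ∑ q, |P (j, a) q|)
        (Set.finite_range _).bddAbove ⟨j, hj⟩).trans hI
    refine le_trans ?_ h1
    rw [← Finset.sum_coe_sort S]
    simp only [Fintype.sum_prod_type]
    rw [Finset.sum_comm]
    refine Finset.sum_le_sum fun m _ => (frobenius_norm_le_sum_abs _).trans (le_of_eq ?_)
    simp only [Matrix.of_apply, m.2, dite_true]
    rw [Finset.sum_comm]

theorem abs_le_Wmax (W : Weights n k) (i j : Fin n) (a c : Fin k) : |W i j a c| ≤ Wmax W :=
  le_ciSup (f := fun p : (Fin n × Fin n) × (Fin k × Fin k) => |W p.1.1 p.1.2 p.2.1 p.2.2|)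
    (Set.finite_range _).bddAbove ((i, j), (a, c))

theorem Wmax_nonneg (W : Weights n k) : 0 ≤ Wmax W := Real.iSup_nonneg fun _ => abs_nonneg _

theorem norm_le_Wmax (W : Weights n k) (i j : Fin n) : ‖W i j‖ ≤ k * Wmax W :=
  frobenius_norm_le_of_forall_abs_le (Wmax_nonneg W) (abs_le_Wmax W i j)

theorem mem_nbr {j : Fin n} : j ∈ nbr W i ↔ W i j ≠ 0 := by
  simp [nbr]

theorem mem_nbrCompl {j : Fin n} : j ∈ nbrCompl W i ↔ j ≠ i ∧ j ∉ nbr W i := by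
  simp [nbrCompl]

theorem notMem_nbr_self (hW : W i i = 0) : i ∉ nbr W i := fun h => mem_nbr.1 h hW

end

/-! ### The residual at the true weights. -/

section

variable {n k T : ℕ} {Ω : Type*} [MeasurableSpace Ω] {μ : Measure Ω} {W : Weights n k} {i : Fin n}
  {σ : ℝ} {e : Fin T → Fin n → Ω → Vec k} {xs : Fin T → Fin n → Vec k}

theorem popMatrix_symm (μ : Measure Ω) (xs : Fin T → Fin n → Vec k)
    (e : Fin T → Fin n → Ω → Vec k) (p q : Fin n × Fin k) :
    popMatrix μ xs e p q = popMatrix μ xs e q p := by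
  simp only [popMatrix, Matrix.of_apply, mul_comm]

/-- The population counterpart of the residual at the true weights: only the variance of the noise
on the regressors contributes. -/
theorem IsNoise.norm_population_resid_le [IsProbabilityMeasure μ] (he : IsNoise μ σ e)
    (hσ : 0 < σ) (hxs : ∀ t, xs t i = ∑ l ∈ nbr W i, act (W i l) (xs t l)) {j : Fin n}
    (hj : j ≠ i) :
    ‖block (popMatrix μ xs e) i j - ∑ l ∈ nbr W i, W i l * block (popMatrix μ xs e) l j‖
      ≤ k * (2 * σ ^ 2 * Wmax W) := by
  have hWm := Wmax_nonneg W
  refine frobenius_norm_le_of_forall_abs_le (by positivity) fun a c => ?_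
  have hentry : (block (popMatrix μ xs e) i j
      - ∑ l ∈ nbr W i, W i l * block (popMatrix μ xs e) l j) a c
      = (1 / (T : ℝ)) * ∑ t, -(W i j a c * ∫ ω, e t j ω c ^ 2 ∂μ) := by
    have h1 : (block (popMatrix μ xs e) i j
        - ∑ l ∈ nbr W i, W i l * block (popMatrix μ xs e) l j) a c
        = block (popMatrix μ xs e) i j a c
          - ∑ l ∈ nbr W i, (W i l * block (popMatrix μ xs e) l j) a c := by
      simp [Matrix.sum_apply]
    have h2 : ∀ l, (W i l * block (popMatrix μ xs e) l j) a c
        = (1 / (T : ℝ)) * ∑ t, (act (W i l) (xs t l) a * xs t j c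
          + ∑ a', W i l a a' * ∫ ω, e t l ω a' * e t j ω c ∂μ) := by
      intro l
      simp only [Matrix.mul_apply, block, popMatrix, Matrix.of_apply, act, Matrix.mulVec,
        dotProduct, Finset.sum_mul]
      simp_rw [← Finset.sum_add_distrib]
      rw [Finset.sum_comm, Finset.mul_sum]
      refine Finset.sum_congr rfl fun a' _ => ?_
      simp only [Finset.mul_sum]
      exact Finset.sum_congr rfl fun t _ => by ring
    rw [h1]
    simp_rw [h2]
    rw [← Finset.mul_sum, Finset.sum_comm]
    simp only [block, popMatrix, Matrix.of_apply]
    rw [← mul_sub, ← Finset.sum_sub_distrib]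
    congr 1
    refine Finset.sum_congr rfl fun t _ => ?_
    rw [Finset.sum_add_distrib, ← Finset.sum_mul]
    -- The equilibrium parts cancel by the linear system. Among the noise moments, independence
    -- leaves only `(l, a') = (j, c)`.
    have h3 : xs t i a = ∑ l ∈ nbr W i, act (W i l) (xs t l) a := by
      conv_lhs => rw [hxs t]
      simp
    have h4 : ∫ ω, e t i ω a * e t j ω c ∂μ = 0 :=
      he.integral_mul_eq_zero t (p := (i, a)) (q := (j, c)) fun h => hj (congrArg Prod.fst h).symm
    have h5 : ∀ l a', (l, a') ≠ (j, c) → ∫ ω, e t l ω a' * e t j ω c ∂μ = 0 := fun l a' h =>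
      he.integral_mul_eq_zero t (p := (l, a')) (q := (j, c)) h
    have h6 : ∑ l ∈ nbr W i, ∑ a', W i l a a' * ∫ ω, e t l ω a' * e t j ω c ∂μ
        = W i j a c * ∫ ω, e t j ω c ^ 2 ∂μ := by
      rw [Finset.sum_eq_single j]
      · rw [Finset.sum_eq_single c]
        · simp only [sq]
        · intro a' _ ha'
          rw [h5 _ _ (by simpa using ha'), mul_zero]
        · simp
      · intro l _ hl
        refine Finset.sum_eq_zero fun a' _ => ?_
        rw [h5 _ _ fun h => hl (congrArg Prod.fst h), mul_zero]
      · intro hjn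
        have : W i j = 0 := by
          by_contra h
          exact hjn (mem_nbr.2 h)
        simp [this]
    rw [← h3, h4, h6]
    ring
  rw [hentry, abs_mul, abs_of_nonneg (by positivity)]
  have hterm : ∀ t : Fin T, |-(W i j a c * ∫ ω, e t j ω c ^ 2 ∂μ)| ≤ 2 * σ ^ 2 * Wmax W := by
    intro t
    rw [abs_neg, abs_mul, abs_of_nonneg (integral_nonneg fun ω => sq_nonneg (e t j ω c)), mul_comm]
    exact mul_le_mul (he.integral_sq_le hσ t (j, c)) (abs_le_Wmax W i j a c) (abs_nonneg _)
      (by positivity)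
  have hsum := (Finset.abs_sum_le_sum_abs (fun t : Fin T => -(W i j a c * ∫ ω, e t j ω c ^ 2 ∂μ))
    Finset.univ).trans (Finset.sum_le_sum fun t _ => hterm t)
  rw [Finset.sum_const, Finset.card_univ, Fintype.card_fin, nsmul_eq_mul] at hsum
  rcases Nat.eq_zero_or_pos T with rfl | hT
  · simp only [Nat.cast_zero, div_zero, zero_mul]
    positivity
  · have hT' : (0 : ℝ) < T := by exact_mod_cast hT
    rw [one_div, inv_mul_le_iff₀ hT']
    exact hsum

/-- The residual at the true weights. -/
theorem IsNoise.norm_empirical_resid_le [IsProbabilityMeasure μ] (he : IsNoise μ σ e)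
    (hσ : 0 < σ) (hxs : ∀ t, xs t i = ∑ l ∈ nbr W i, act (W i l) (xs t l))
    {B : Matrix (Fin n × Fin k) (Fin n × Fin k) ℝ} {κ : ℝ}
    (hB : ∀ l j, ‖block B l j - block (popMatrix μ xs e) l j‖ ≤ κ) {j : Fin n} (hj : j ≠ i) :
    ‖block B i j - ∑ l ∈ nbr W i, W i l * block B l j‖
      ≤ k * (2 * σ ^ 2 * Wmax W) + κ + k * Wmax W * (κ * (nbr W i).card) := by
  set H := popMatrix μ xs e with hH
  have hWm := Wmax_nonneg W
  have heq : block B i j - ∑ l ∈ nbr W i, W i l * block B l j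
      = (block H i j - ∑ l ∈ nbr W i, W i l * block H l j) + (block B i j - block H i j)
        - ∑ l ∈ nbr W i, W i l * (block B l j - block H l j) := by
    simp only [mul_sub, Finset.sum_sub_distrib]
    abel
  have h1 : ‖∑ l ∈ nbr W i, W i l * (block B l j - block H l j)‖
      ≤ k * Wmax W * (κ * (nbr W i).card) := by
    calc _ ≤ ∑ l ∈ nbr W i, ‖W i l * (block B l j - block H l j)‖ := norm_sum_le _ _
      _ ≤ ∑ _l ∈ nbr W i, k * Wmax W * κ := Finset.sum_le_sum fun l _ =>
          (Matrix.frobenius_norm_mul _ _).trans (mul_le_mul (norm_le_Wmax W i l) (hB l j)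
            (norm_nonneg _) (by positivity))
      _ = _ := by
          rw [Finset.sum_const, nsmul_eq_mul]
          ring
  rw [heq]
  refine (norm_sub_le _ _).trans (add_le_add ((norm_add_le _ _).trans
    (add_le_add (he.norm_population_resid_le hσ hxs hj) (hB i j))) h1)

end

/-! ### From supported minimizers to the claims about estimates. -/

section

variable {n k T : ℕ} {W : Weights n k} {A : Fin n → Set (Vec k)} {α b lam : ℝ}
  {X : Fin T → Fin n → Vec k} {δ : Fin n → ℝ}

/-- Payoffs are never positive, so it suffices that the player's own payoff exceeds `-ε i`; it is
minus the norm of the weight errors applied to bounded actions. -/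
theorem linearSolutions_subset_epsNashSet {W' : Weights n k} (hW : ∀ i, W i i = 0)
    (hA : ∀ i, ∀ y ∈ A i, ‖y‖ ≤ b) (hsupp : ∀ i, ∀ j ∉ nbr W i, W' i j = 0)
    (hδ : ∀ i, ∀ j ∈ nbr W i, ‖W' i j - W i j‖ ≤ δ i) :
    linearSolutions A W' ⊆ epsNashSet A W fun i => ((nbr W i).card : ℝ) * δ i * b := by
  rintro x ⟨hxA, hx⟩
  refine ⟨hxA, fun i y _ => ?_⟩
  have h1 : x i = ∑ j ∈ nbr W i, act (W' i j) (x j) := by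
    rw [hx i]
    symm
    refine Finset.sum_subset (fun j hj => Finset.mem_erase.2
      ⟨fun h => notMem_nbr_self (hW i) (h ▸ hj), Finset.mem_univ _⟩) fun j _ hj => ?_
    rw [hsupp i j hj, act_zero]
  have h2 : x i - ∑ j ∈ nbr W i, act (W i j) (x j)
      = ∑ j ∈ nbr W i, act (W' i j - W i j) (x j) := by
    rw [sub_eq_iff_eq_add, ← Finset.sum_add_distrib]
    refine h1.trans (Finset.sum_congr rfl fun j _ => ?_)
    rw [← act_add, sub_add_cancel]
  have h3 : ‖x i - ∑ j ∈ nbr W i, act (W i j) (x j)‖ ≤ (nbr W i).card * δ i * b := by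
    rw [h2]
    calc _ ≤ ∑ j ∈ nbr W i, ‖act (W' i j - W i j) (x j)‖ := norm_sum_le _ _
      _ ≤ ∑ _j ∈ nbr W i, δ i * b := Finset.sum_le_sum fun j hj =>
          (norm_act_le _ _).trans (mul_le_mul (hδ i j hj) (hA j _ (hxA j)) (norm_nonneg _)
            ((norm_nonneg _).trans (hδ i j hj)))
      _ = _ := by rw [Finset.sum_const, nsmul_eq_mul, mul_assoc]
  have h4 : payoff W i y x ≤ 0 := neg_nonpos.2 (norm_nonneg _)
  have h5 : payoff W i (x i) x = -‖x i - ∑ j ∈ nbr W i, act (W i j) (x j)‖ := rfl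
  linarith

theorem success_of_isSupportedMin (hlam : 0 < lam) (hW : ∀ i, W i i = 0)
    (hA : ∀ i, ∀ y ∈ A i, ‖y‖ ≤ b) (hδ0 : α < 1 → ∀ i, 0 ≤ δ i)
    (hR : ∀ i V, IsSupportedMin lam X i (nbr W i) V →
      ∀ j, j ≠ i → j ∉ nbr W i → ‖resid X i V j‖ < lam / 2)
    (hδ : α < 1 → ∀ i V, IsSupportedMin lam X i (nbr W i) V →
      ∀ j ∈ nbr W i, ‖V j - W i j‖ ≤ δ i) :
    Success A W α b lam δ X := by
  have hS : ∀ i, i ∉ nbr W i := fun i => notMem_nbr_self (hW i)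
  choose V hV using fun i => exists_isSupportedMin hlam X i (hS i)
  have hmin := fun i => (hV i).isMin hlam.le (hS i) (hR i (V i) (hV i))
  refine ⟨⟨V, fun i => ⟨(hV i).1 i (hS i), (hmin i).1⟩⟩, fun W' hW' => ?_⟩
  -- An arbitrary estimate is itself a supported minimizer, so the error bound applies to it
  -- directly and no uniqueness is needed.
  have hM : ∀ i, IsSupportedMin lam X i (nbr W i) (W' i) := fun i =>
    (hmin i).2 (W' i) (hW' i).1 (hW' i).2
  have hsub : ∀ i, nbr W' i ⊆ nbr W i := fun i j hj => by
    by_contra h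
    exact mem_nbr.1 hj ((hM i).1 j h)
  refine ⟨hsub, fun hα => ?_⟩
  have hd := fun i => hδ hα i (W' i) (hM i)
  have hall : ∀ i j, ‖W' i j - W i j‖ ≤ δ i := fun i j => by
    by_cases hj : j ∈ nbr W i
    · exact hd i j hj
    · have h0 : W i j = 0 := by
        by_contra h
        exact hj (mem_nbr.2 h)
      rw [(hM i).1 j hj, h0, sub_zero, norm_zero]
      exact hδ0 hα i
  refine ⟨fun i j => by rw [frob_eq_norm]; exact hall i j,
    linearSolutions_subset_epsNashSet hW hA (fun i => (hM i).1) hd, fun i hi => ?_⟩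
  refine (hsub i).antisymm fun j hj => mem_nbr.2 fun h0 => ?_
  have h1 := hi j hj
  have h2 := hall i j
  have h3 := hδ0 hα i
  rw [frob_eq_norm] at h1
  rw [h0, zero_sub, norm_neg] at h2
  linarith

/-- The three plain terms `αlam / (24(1 - α))` of the radius cover `αlam / 8`. The term with `wM` is
only needed to be nonnegative, which also holds for `wM = 0` since division by zero gives zero. -/
theorem le_delta {s : ℕ} {c σ wM : ℝ} (hk : 1 ≤ k) (hc : 0 < c) (hα : 0 < α) (hα1 : α < 1)
    (hlam : 0 < lam) (hwM : 0 ≤ wM) :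
    2 / c * (√s * (α * lam / 8 + lam / 2)) ≤ delta k s c α lam σ wM := by
  have hk' : (1 : ℝ) ≤ k := by exact_mod_cast hk
  have h1α : 0 < 1 - α := by linarith
  have hA : α * lam / 24 ≤ α * lam / (24 * (1 - α)) := by
    gcongr
    linarith
  have hP : 0 ≤ σ ^ 2 * (1 + α * lam / (24 * (1 - α) * σ ^ 2 * √k * wM)
      + α * lam / (24 * (1 - α) * σ ^ 2 * √k * wM)) * (√k * wM) := by positivity
  have hs : √(s : ℝ) ≤ k * √(k * s) := by
    have h1 : √(s : ℝ) ≤ √(k * s) := Real.sqrt_le_sqrt (le_mul_of_one_le_left (by positivity) hk')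
    exact h1.trans (le_mul_of_one_le_left (Real.sqrt_nonneg _) hk')
  unfold delta
  set P := σ ^ 2 * (1 + α * lam / (24 * (1 - α) * σ ^ 2 * √k * wM)
      + α * lam / (24 * (1 - α) * σ ^ 2 * √k * wM)) * (√k * wM)
  set a := α * lam / (24 * (1 - α))
  calc 2 / c * (√s * (α * lam / 8 + lam / 2))
      ≤ 2 / c * (k * √(k * s) * (a + P + (a + a) + lam / 2)) := by
        gcongr
        linarith
    _ = _ := by ring

theorem delta_nonneg {s : ℕ} {c σ wM : ℝ} (hk : 1 ≤ k) (hc : s ≠ 0 → 0 < c) (hα : 0 < α)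
    (hα1 : α < 1) (hlam : 0 < lam) (hwM : 0 ≤ wM) : 0 ≤ delta k s c α lam σ wM := by
  rcases eq_or_ne s 0 with rfl | hs
  · simp [delta]
  · have := hc hs
    exact le_trans (by positivity) (le_delta hk this hα hα1 hlam hwM)

end

/-! ### Bounds for one player on the good event. -/

section

variable {n k T : ℕ} {Ω : Type*} [MeasurableSpace Ω] {μ : Measure Ω} [IsProbabilityMeasure μ]
  {W : Weights n k} {i : Fin n} {σ α c c₁ κ lam : ℝ} {e : Fin T → Fin n → Ω → Vec k}
  {xs X : Fin T → Fin n → Vec k}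

theorem IsSupportedMin.bounds {V : Fin n → Matrix (Fin k) (Fin k) ℝ}
    (hV : IsSupportedMin lam X i (nbr W i) V) (he : IsNoise μ σ e) (hσ : 0 < σ) (hα : 0 < α)
    (hα1 : α ≤ 1) (hlam : 0 < lam) (hc : 0 < c) (hW : W i i = 0)
    (hxs : ∀ t, xs t i = ∑ l ∈ nbr W i, act (W i l) (xs t l))
    (hI : MutualIncoherence (popMatrix μ xs e) W i α)
    (hC : (nbr W i).Nonempty → c ≤ Cmin (popMatrix μ xs e) W i)
    (hthr : 24 * σ ^ 2 * k * Wmax W / α < lam)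
    (hX : ∀ l j, ‖block (empMatrix X) l j - block (popMatrix μ xs e) l j‖ ≤ κ)
    (hκ : 0 ≤ κ) (hκ₁ : κ ≤ c₁) (hκs : κ * (nbr W i).card ≤ c₁) (hc₁α : c₁ ≤ α * lam / 48)
    (hc₁σ : c₁ ≤ σ ^ 2 / 2) (hc₁c : c₁ ≤ c * α / 32) :
    (∀ j, j ≠ i → j ∉ nbr W i → ‖resid X i V j‖ < lam / 2) ∧
    ∀ j ∈ nbr W i, ‖V j - W i j‖ ≤ 2 / c * (√(nbr W i).card * (α * lam / 8 + lam / 2)) := by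
  have hi := notMem_nbr_self hW
  have hsymm := popMatrix_symm μ xs e
  have hWm := Wmax_nonneg W
  set D : Fin n → Matrix (Fin k) (Fin k) ℝ := fun j => V j - W i j with hD
  set N : Fin n → Matrix (Fin k) (Fin k) ℝ := fun j => block (empMatrix X) i j
    - ∑ l ∈ nbr W i, W i l * block (empMatrix X) l j with hNdef
  have hcoer := mul_sum_norm_sq_le hsymm hC D
  have hRN : ∀ j, resid X i V j = N j - ∑ l ∈ nbr W i, D l * block (empMatrix X) l j := by
    intro j
    have h1 : ∑ l ∈ Finset.univ.erase i, V l * block (empMatrix X) l j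
        = ∑ l ∈ nbr W i, V l * block (empMatrix X) l j := by
      symm
      refine Finset.sum_subset (fun l hl => Finset.mem_erase.2
        ⟨fun h => hi (h ▸ hl), Finset.mem_univ _⟩) fun l _ hl => ?_
      rw [hV.1 l hl, zero_mul]
    simp only [resid, h1, hNdef, hD, sub_mul, Finset.sum_sub_distrib]
    abel
  -- The threshold gives `σ² k Wmax ≤ αlam / 24`. So the bias is at most `αlam / 12`, and the two
  -- fluctuation terms are at most `αlam / 48` each.
  have hN : ∀ j, j ≠ i → ‖N j‖ ≤ α * lam / 8 := by
    intro j hj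
    refine (he.norm_empirical_resid_le hσ hxs hX hj).trans ?_
    rw [div_lt_iff₀ hα] at hthr
    have h1 : k * Wmax W * (κ * (nbr W i).card) ≤ k * Wmax W * (σ ^ 2 / 2) := by
      gcongr
      exact hκs.trans hc₁σ
    nlinarith
  have hNS : ∀ j ∈ nbr W i, ‖N j‖ ≤ α * lam / 8 := fun j hj => hN j fun h => hi (h ▸ hj)
  have hRS : ∀ j ∈ nbr W i, ‖resid X i V j‖ ≤ lam / 2 := fun j hj =>
    hV.norm_resid_le hlam.le hi hj
  have hν : 0 ≤ α * lam / 8 := by positivity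
  refine ⟨fun j hji hj => ?_, fun j hj => ?_⟩
  · obtain ⟨Q, hQ, hQα⟩ := hI.exists_coeff hα1 hc hsymm hC (mem_nbrCompl.2 ⟨hji, hj⟩)
    exact norm_lt_of_incoherent hc hX hκ hcoer hRN hNS hRS hν hlam hα hα1 (hκs.trans hc₁c) le_rfl
      (hN j hji) hQ hQα
  · refine le_trans ?_ (sqrt_sum_norm_sq_le hc hX hκ hcoer hRN hNS hRS hν hlam.le
      (hκs.trans (hc₁c.trans (by nlinarith))))
    apply Real.le_sqrt_of_sq_le
    exact Finset.single_le_sum (f := fun l => ‖D l‖ ^ 2) (fun _ _ => sq_nonneg _) hj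

end

/-- The absorption of the union bound into the exponential tail. -/
theorem two_mul_sq_mul_exp_le {n k d T : ℕ} {r c : ℝ} (hr : 0 < r) (hc : 0 < c) (hn : 2 ≤ n)
    (hk : 1 ≤ k) (hd : 1 ≤ d)
    (hT : 6 / (r * c ^ 2) * (k : ℝ) ^ 5 * (d : ℝ) ^ 3 * Real.log (d * n * k) ≤ T) :
    2 * ((n : ℝ) * k) ^ 2 * Real.exp (-(r * (T * (c / (k * d)) ^ 2)))
      ≤ Real.exp (-(r * c ^ 2 / 2 * T / ((k : ℝ) ^ 5 * (d : ℝ) ^ 3))) := by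
  have hn' : (2 : ℝ) ≤ n := by exact_mod_cast hn
  have hk' : (1 : ℝ) ≤ k := by exact_mod_cast hk
  have hd' : (1 : ℝ) ≤ d := by exact_mod_cast hd
  set q : ℝ := d * n * k with hq
  have hnk : (n : ℝ) * k ≤ q := by
    rw [hq, mul_assoc]
    exact le_mul_of_one_le_left (by positivity) hd'
  have hq2 : 2 ≤ q := by nlinarith
  -- Since `q ≥ 2` and `q ≥ n k`, the union-bound factor is at most `q³`. The constant 6 makes `3
  -- log q` at most half of the exponent; the other half is the final rate.
  have h1 : 2 * ((n : ℝ) * k) ^ 2 ≤ Real.exp (3 * Real.log q) := by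
    have : Real.exp (3 * Real.log q) = q ^ 3 := by
      rw [mul_comm, Real.exp_mul, Real.exp_log (by linarith)]
      norm_num
    rw [this]
    calc 2 * ((n : ℝ) * k) ^ 2 ≤ q * q ^ 2 := by gcongr
      _ = q ^ 3 := by ring
  set τ : ℝ := T / ((k : ℝ) ^ 5 * (d : ℝ) ^ 3) with hτ
  have h2 : c ^ 2 * τ ≤ T * (c / (k * d)) ^ 2 := by
    have h3 : T * (c / (k * d)) ^ 2 = c ^ 2 * (T / ((k : ℝ) ^ 2 * (d : ℝ) ^ 2)) := by
      field_simp
    rw [h3, hτ]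
    have h4 : (k : ℝ) ^ 2 ≤ (k : ℝ) ^ 5 := pow_le_pow_right₀ hk' (by norm_num)
    have h5 : (d : ℝ) ^ 2 ≤ (d : ℝ) ^ 3 := pow_le_pow_right₀ hd' (by norm_num)
    gcongr
  have h6 : 6 / (r * c ^ 2) * Real.log q ≤ τ := by
    rw [hτ, le_div_iff₀ (by positivity)]
    refine le_trans (le_of_eq ?_) hT
    ring
  have h7 : 6 * Real.log q ≤ r * c ^ 2 * τ := by
    rw [div_mul_eq_mul_div, div_le_iff₀ (by positivity)] at h6
    linarith
  have h8 : r * (c ^ 2 * τ) ≤ r * (T * (c / (k * d)) ^ 2) := by gcongr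
  calc _ ≤ Real.exp (3 * Real.log q) * Real.exp (-(r * (T * (c / (k * d)) ^ 2))) := by gcongr
    _ = Real.exp (3 * Real.log q + -(r * (T * (c / (k * d)) ^ 2))) := (Real.exp_add _ _).symm
    _ ≤ _ := by
        apply Real.exp_le_exp.2
        rw [mul_div_assoc, ← hτ]
        linarith

end QuadGame

end

/-! ### Assembly. -/

theorem theorem1 (σ b α c₀ lam₀ : ℝ) (hσ : 0 < σ) (hb : 0 < b) (hα : 0 < α) (hα1 : α ≤ 1)
    (hc₀ : 0 < c₀) (hlam₀ : 0 < lam₀) :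
    ∃ C > 0, ∃ K > 0, ∀ (n k d T : ℕ) (A : Fin n → Set (QuadGame.Vec k))
      (W : QuadGame.Weights n k) (xs : Fin T → Fin n → QuadGame.Vec k)
      (Ω : Type*) [MeasurableSpace Ω] (μ : Measure Ω) [IsProbabilityMeasure μ]
      (e : Fin T → Fin n → Ω → QuadGame.Vec k) (lam : ℝ),
      1 ≤ k → 1 ≤ d →
      (∀ i, W i i = 0) →
      (∀ i, (QuadGame.nbr W i).card ≤ d) →
      -- budgeted actions
      (∀ i, ∀ y ∈ A i, ‖y‖ ≤ b) →
      -- zero maximal utility at equilibrium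
      (∀ x ∈ QuadGame.nashSet A W, ∀ i, QuadGame.payoff W i (x i) x = 0) →
      -- the unperturbed samples are equilibria
      (∀ t, xs t ∈ QuadGame.nashSet A W) →
      QuadGame.IsNoise μ σ e →
      (∀ i, QuadGame.MutualIncoherence (QuadGame.popMatrix μ xs e) W i α) →
      (∀ i, (QuadGame.nbr W i).Nonempty →
        c₀ ≤ QuadGame.Cmin (QuadGame.popMatrix μ xs e) W i) →
      lam₀ ≤ lam →
      (∀ i, QuadGame.ExceedsThreshold k T (QuadGame.nbr W i).card (QuadGame.nbrCompl W i).card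
        σ b α (QuadGame.Wmax W) (QuadGame.Wmin W) lam) →
      C * (k : ℝ) ^ 5 * (d : ℝ) ^ 3 * Real.log (d * n * k) ≤ T →
      μ {ω | ¬ QuadGame.Success A W α b lam
          (fun i => QuadGame.delta k (QuadGame.nbr W i).card
            (QuadGame.Cmin (QuadGame.popMatrix μ xs e) W i) α lam σ (QuadGame.Wmax W))
          (fun t i => xs t i + e t i ω)}
        ≤ ENNReal.ofReal (Real.exp (-(K * T / ((k : ℝ) ^ 5 * (d : ℝ) ^ 3)))) := by
  -- The admissible fluctuation: the first two entries control the residual at the true weights, the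
  -- third the perturbation of the population matrix.
  set c₁ : ℝ := min (α * lam₀ / 48) (min (σ ^ 2 / 2) (c₀ * α / 32)) with hc₁
  have hc₁0 : 0 < c₁ := lt_min (by positivity) (lt_min (by positivity) (by positivity))
  have hr := QuadGame.tailRate_pos hσ b
  refine ⟨6 / (QuadGame.tailRate σ b * c₁ ^ 2), by positivity,
    QuadGame.tailRate σ b * c₁ ^ 2 / 2, by positivity, ?_⟩
  intro n k d T A W xs Ω _ μ _ e lam hk hd hW hcard hA hzero hxs he hI hC hlam hthr hT
  have hk' : (1 : ℝ) ≤ k := by exact_mod_cast hk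
  have hd' : (1 : ℝ) ≤ d := by exact_mod_cast hd
  have hlam0 : 0 < lam := hlam₀.trans_le hlam
  have hWm := QuadGame.Wmax_nonneg W
  have hδ0 : α < 1 → ∀ i, 0 ≤ QuadGame.delta k (QuadGame.nbr W i).card
      (QuadGame.Cmin (QuadGame.popMatrix μ xs e) W i) α lam σ (QuadGame.Wmax W) := fun hα1' i =>
    QuadGame.delta_nonneg hk
      (fun hs => hc₀.trans_le (hC i (Finset.card_ne_zero.1 hs))) hα hα1' hlam0 hWm
  -- With fewer than two players the logarithm may vanish and `T` may be zero, but there are no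
  -- regressors and success is certain.
  rcases lt_or_ge n 2 with hn | hn
  · have hsub : Subsingleton (Fin n) := Fin.subsingleton_iff_le_one.2 (by omega)
    have hempty : {ω | ¬ QuadGame.Success A W α b lam
          (fun i => QuadGame.delta k (QuadGame.nbr W i).card
            (QuadGame.Cmin (QuadGame.popMatrix μ xs e) W i) α lam σ (QuadGame.Wmax W))
          (fun t i => xs t i + e t i ω)} = ∅ := by
      refine Set.eq_empty_of_forall_notMem fun ω hω => hω ?_
      refine QuadGame.success_of_isSupportedMin hlam0 hW hA hδ0
        (fun i V _ j hj => absurd (Subsingleton.elim j i) hj) fun _ i V _ j hj => ?_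
      exact absurd (Subsingleton.elim j i ▸ hj) (QuadGame.notMem_nbr_self (hW i))
    rw [hempty, measure_empty]
    exact zero_le
  have hn' : (2 : ℝ) ≤ n := by exact_mod_cast hn
  have hlog : 0 < Real.log (d * n * k) := by
    apply Real.log_pos
    have h1 : (1 : ℝ) * 2 ≤ d * n := mul_le_mul hd' hn' (by norm_num) (by positivity)
    nlinarith
  have hTpos : 0 < T := by
    have h1 : (0 : ℝ) < T := lt_of_lt_of_le (by positivity) hT
    exact_mod_cast h1
  have heq : ∀ t i, xs t i = ∑ l ∈ QuadGame.nbr W i, QuadGame.act (W i l) (xs t l) := by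
    intro t i
    have h1 := hzero (xs t) (hxs t) i
    rw [QuadGame.payoff, neg_eq_zero, norm_eq_zero, sub_eq_zero] at h1
    exact h1
  have hxb : ∀ t i, ‖xs t i‖ ≤ b := fun t i => hA i _ ((hxs t).1 i)
  set ε : ℝ := c₁ / (k * d) with hε
  have hε0 : 0 ≤ ε := by positivity
  have hεc : ε ≤ c₁ := div_le_self hc₁0.le (by nlinarith)
  have hc₁σ : c₁ ≤ σ ^ 2 / 2 := (min_le_right _ _).trans (min_le_left _ _)
  have hc₁c : c₁ ≤ c₀ * α / 32 := (min_le_right _ _).trans (min_le_right _ _)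
  have hc₁l : c₁ ≤ α * lam / 48 := (min_le_left _ _).trans (by gcongr)
  have hprob := he.measure_exists_empMatrix_dev_le hσ hTpos hxb hε0
    (hεc.trans (by nlinarith [sq_nonneg σ]))
  refine (measure_mono (t := {ω | ∃ p q, ε ≤ |QuadGame.empMatrix (fun t i => xs t i + e t i ω) p q
    - QuadGame.popMatrix μ xs e p q|}) fun ω hω => ?_).trans ?_
  · by_contra hgood
    apply hω
    simp only [Set.mem_ofPred_eq, not_exists, not_le] at hgood
    have hX : ∀ l j, QuadGame.frob
        (QuadGame.block (QuadGame.empMatrix fun t i => xs t i + e t i ω) l j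
        - QuadGame.block (QuadGame.popMatrix μ xs e) l j) ≤ c₁ / d := fun l j => by
      rw [QuadGame.frob_eq_norm]
      refine (QuadGame.frobenius_norm_le_of_forall_abs_le hε0 fun a c =>
        (hgood (l, a) (j, c)).le).trans (le_of_eq ?_)
      rw [hε]
      field_simp
    simp_rw [QuadGame.frob_eq_norm] at hX
    have hκs : ∀ i, c₁ / d * (QuadGame.nbr W i).card ≤ c₁ := fun i => by
      have h1 : ((QuadGame.nbr W i).card : ℝ) ≤ d := by exact_mod_cast hcard i
      calc c₁ / d * (QuadGame.nbr W i).card ≤ c₁ / d * d := by gcongr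
        _ = c₁ := by field_simp
    have hthr' := fun i => (hthr i).2.2.2.2.2.2.2.2.2.2
    -- The eigenvalue bound `c` stays free. Dual feasibility uses `c₀`, since `Cmin` of an empty
    -- neighbourhood is not bounded below by `c₀`; the radius uses `Cmin` itself, where the
    -- neighbourhood is nonempty.
    have hb1 := fun i (V : Fin n → Matrix (Fin k) (Fin k) ℝ)
        (hV : QuadGame.IsSupportedMin lam (fun t i => xs t i + e t i ω) i (QuadGame.nbr W i) V)
        c (hcc : c₀ ≤ c) hC' =>
      hV.bounds (c := c) he hσ hα hα1 hlam0 (hc₀.trans_le hcc) (hW i) (fun t => heq t i) (hI i) hC'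
        (hthr' i) hX (by positivity) (div_le_self hc₁0.le hd') (hκs i) hc₁l hc₁σ
        (hc₁c.trans (by gcongr))
    refine QuadGame.success_of_isSupportedMin hlam0 hW hA hδ0
      (fun i V hV => (hb1 i V hV c₀ le_rfl (hC i)).1) fun hα1' i V hV j hj => ?_
    have hCi := hC i ⟨j, hj⟩
    exact ((hb1 i V hV _ hCi fun _ => le_rfl).2 j hj).trans
      (QuadGame.le_delta hk (hc₀.trans_le hCi) hα hα1' hlam0 hWm)
  · rw [← ofReal_measureReal]
    exact ENNReal.ofReal_le_ofReal
      (hprob.trans (QuadGame.two_mul_sq_mul_exp_le hr hc₁0 hn hk hd hT))
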